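/- For a set $A\subset\mathbb R^3$ and $p,q\in A$ let $d_A(p,q)\in[0,\infty]$ be the infimum of the lengths of the continuous paths in $A$ from $p$ to $q$, and let the distortion of $A$ be $$\delta(A)=\sup_{p,q\in A,\ p\neq q}\frac{d_A(p,q)}{|p-q|}\in[0,\infty].$$ A convex embedding of the $2$-sphere is a topological embedding $f:S^2\to\mathbb R^3$ whose image $f(S^2)$ is the boundary of a compact convex set with nonempty interior. The eccentricity of an embedded $2$-sphere $\Sigma\subset\mathbb R^3$ is the ratio of its circumradius (the smallest radius of a ball containing $\Sigma$) and its inradius (the largest radius of a ball whose interior lies in the bounded region enclosed by $\Sigma$). Theorem 2. There exists a convex embedding $f:S^2\to\mathbb R^3$ of the $2$-sphere that minimises the distortion among all convex embeddings, i.e. $\delta(f(S^2))\le\delta(g(S^2))$ for every convex embedding $g:S^2\to\mathbb R^3$. Moreover, there is a constant $C<\infty$ such that for every such minimiser $f$ the eccentricity of $f(S^2)$ is at most $C$. -/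

import Mathlib

open scoped ENNReal NNReal

noncomputable section

namespace ConvexSphere

/-- Euclidean three-space. -/
abbrev E3 : Type := EuclideanSpace ℝ (Fin 3)

/-- The standard `2`-sphere, i.e. the unit sphere of Euclidean three-space. -/
abbrev S2 : Type := Metric.sphere (0 : E3) 1

/-- The intrinsic distance of `p` and `q` in `A`: the infimum of the lengths (total variations)
of the continuous paths from `p` to `q` that stay in `A`; it is `∞` if there is no such path of
finite length. -/
def intrinsicEDist (A : Set E3) (p q : E3) : ℝ≥0∞ :=
  ⨅ (γ : Path p q) (_ : ∀ t, γ t ∈ A), eVariationOn γ Set.univ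

/-- The distortion of `A`: the supremum, over pairs of distinct points of `A`, of the ratio
between the intrinsic distance in `A` and the Euclidean distance. -/
def distortion (A : Set E3) : ℝ≥0∞ :=
  ⨆ (p ∈ A) (q ∈ A) (_ : p ≠ q), intrinsicEDist A p q / edist p q

/-- A convex embedding of the `2`-sphere: a topological embedding into Euclidean three-space
whose image is the boundary of a compact convex set with nonempty interior. -/
def IsConvexEmbedding (f : S2 → E3) : Prop :=
  Topology.IsEmbedding f ∧
    ∃ K : ConvexBody E3, (interior (K : Set E3)).Nonempty ∧ Set.range f = frontier (K : Set E3)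

/-- A convex embedding whose image has the least distortion among the images of all convex
embeddings of the `2`-sphere. -/
def IsConvexMinimiser (f : S2 → E3) : Prop :=
  IsConvexEmbedding f ∧
    ∀ g : S2 → E3, IsConvexEmbedding g → distortion (Set.range f) ≤ distortion (Set.range g)

/-- The circumradius of `A`: the infimum of the radii of the balls that contain `A`. -/
def circumradius (A : Set E3) : ℝ≥0∞ :=
  ⨅ c : E3, ⨆ x ∈ A, edist x c

/-- The region enclosed by `A`: the union of the bounded connected components of the complement
of `A`. -/
def enclosedRegion (A : Set E3) : Set E3 :=
  {x | x ∉ A ∧ Bornology.IsBounded (connectedComponentIn Aᶜ x)}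

/-- The inradius of `A`: the supremum of the radii of the open balls contained in the region
enclosed by `A`. -/
def inradius (A : Set E3) : ℝ≥0∞ :=
  ⨆ (c : E3) (r : ℝ≥0) (_ : Metric.ball c (r : ℝ) ⊆ enclosedRegion A), (r : ℝ≥0∞)

/-- The eccentricity of `A`: the ratio of its circumradius and its inradius. -/
def eccentricity (A : Set E3) : ℝ≥0∞ :=
  circumradius A / inradius A

end ConvexSphere

end

namespace ConvexSphere

open Set Metric

/-! The threshold is `π / 2`. A long thin convex body looks near its middle like a cylinder over a
planar convex curve, and a closed planar convex curve has distortion at least `π / 2`. So a bound `κ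
< π / 2` on the distortion bounds the eccentricity (`exists_ball_of_distortion_le`). An explicit
circular cone has distortion at most `1.56 < π / 2` (`exists_convex_distortion_le`), so every
minimiser, and every minimising sequence after finitely many terms, falls under this bound.

The eccentricity bound has two steps. In `exists_far_point_of_distortion_le` the body is cut
orthogonally to a diameter at its midpoint. The slice has two boundary points that halve its
perimeter `L` and lie at distance about `L / π` or less (`exists_halving_pair`). If the slice were
small compared with the diameter, a path on the surface joining nearby points would either run far
along the axis or project to a path of length almost `L / 2` around the slice; both contradict the
distortion bound. Hence the body contains a fat triangle, and so a disc. By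
`exists_ball_subset_of_disc_subset` the body has height comparable to the disc, since a surface path
from one side of the disc to the other must go around it.

For existence, a minimising sequence is rescaled to lie between two fixed balls, and Blaschke
selection (`exists_limit_of_isSolidConvex`) gives a limit body. Lower semicontinuity of the
distortion is `IsSolidConvex.intrinsicEDist_le`: nearest-point projection onto a slightly shrunken
copy of the limit does not increase length and carries the boundary of an approximating body onto
the boundary of that copy. -/

theorem exists_mem_frontier_of_isPreconnected {X : Type*} [TopologicalSpace X] {t s : Set X}
    (ht : IsPreconnected t) (h₁ : (t ∩ s).Nonempty) (h₂ : (t \ s).Nonempty) :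
    (t ∩ frontier s).Nonempty := by
  by_contra hne
  have hsub : t ⊆ interior s ∪ (closure s)ᶜ := by
    intro x hx
    by_cases hxc : x ∈ closure s
    · by_cases hxi : x ∈ interior s
      · exact Or.inl hxi
      · exact absurd ⟨x, hx, hxc, hxi⟩ hne
    · exact Or.inr hxc
  obtain ⟨x, hxt, hxs⟩ := h₁
  obtain ⟨y, hyt, hys⟩ := h₂
  obtain ⟨z, -, hz1, hz2⟩ := ht _ _ isOpen_interior isClosed_closure.isOpen_compl hsub
    ⟨x, hxt, (hsub hxt).resolve_right fun h => h (subset_closure hxs)⟩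
    ⟨y, hyt, (hsub hyt).resolve_left fun h => hys (interior_subset h)⟩
  exact hz2 (interior_subset_closure hz1)

/-! ### Nearest-point projection onto a convex set -/

section Projection

variable {E : Type*} [NormedAddCommGroup E] [InnerProductSpace ℝ E]

/-- `π` is the nearest point projection onto the convex set `C`, in its variational form. -/
def IsMetricProj (C : Set E) (π : E → E) : Prop :=
  ∀ x, π x ∈ C ∧ ∀ y ∈ C, inner ℝ (x - π x) (y - π x) ≤ 0

theorem exists_isMetricProj {C : Set E} (hne : C.Nonempty) (hc : IsComplete C)
    (hconv : Convex ℝ C) : ∃ π : E → E, IsMetricProj C π := by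
  have h : ∀ x : E, ∃ z, z ∈ C ∧ ∀ y ∈ C, inner ℝ (x - z) (y - z) ≤ 0 := by
    intro x
    obtain ⟨z, hz, hxz⟩ := exists_norm_eq_iInf_of_complete_convex hne hc hconv x
    exact ⟨z, hz, (norm_eq_iInf_iff_real_inner_le_zero hconv hz).1 hxz⟩
  choose π hπ using h
  exact ⟨π, hπ⟩

namespace IsMetricProj

variable {C : Set E} {π : E → E}

theorem mem (h : IsMetricProj C π) (x : E) : π x ∈ C := (h x).1

theorem eq_of_forall_inner_le (h : IsMetricProj C π) {x z : E} (hz : z ∈ C)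
    (hxz : ∀ y ∈ C, inner ℝ (x - z) (y - z) ≤ 0) : π x = z := by
  have h1 := (h x).2 z hz
  have h2 := hxz (π x) (h.mem x)
  have h3 : inner ℝ (π x - z) (π x - z) ≤ 0 := by
    have e : inner ℝ (π x - z) (π x - z)
        = inner ℝ (x - π x) (z - π x) + inner ℝ (x - z) (π x - z) := by
      simp only [inner_sub_left, inner_sub_right]
      ring
    linarith
  have h4 := real_inner_self_eq_norm_sq (π x - z)
  have h5 : ‖π x - z‖ = 0 := by nlinarith [norm_nonneg (π x - z)]
  exact sub_eq_zero.1 (norm_eq_zero.1 h5)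

theorem lipschitz (h : IsMetricProj C π) : LipschitzWith 1 π := by
  refine LipschitzWith.of_dist_le_mul fun x y => ?_
  rw [NNReal.coe_one, one_mul, dist_eq_norm, dist_eq_norm]
  have h1 := (h x).2 (π y) (h.mem y)
  have h2 := (h y).2 (π x) (h.mem x)
  have e : inner ℝ (x - y) (π x - π y) = inner ℝ (π x - π y) (π x - π y)
      - inner ℝ (x - π x) (π y - π x) - inner ℝ (y - π y) (π x - π y) := by
    simp only [inner_sub_left, inner_sub_right]
    ring
  rw [real_inner_self_eq_norm_sq] at e
  have h3 := real_inner_le_norm (x - y) (π x - π y)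
  by_contra! hlt
  nlinarith [norm_nonneg (x - y), norm_nonneg (π x - π y)]

theorem norm_sub_le (h : IsMetricProj C π) (x : E) {y : E} (hy : y ∈ C) :
    ‖x - π x‖ ≤ ‖x - y‖ := by
  have h1 := (h x).2 y hy
  have e : inner ℝ (x - y) (x - π x) = inner ℝ (x - π x) (x - π x)
      - inner ℝ (x - π x) (y - π x) := by
    rw [← inner_sub_right, real_inner_comm]
    congr 1
    abel
  rw [real_inner_self_eq_norm_sq] at e
  have h3 := real_inner_le_norm (x - y) (x - π x)
  by_contra! hlt
  nlinarith [norm_nonneg (x - y), norm_nonneg (x - π x)]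

/-- If `π x` were interior, a small step from it towards `x` would stay in `C` and violate the
variational inequality. This is what turns paths outside the interior of `C` into paths in its
boundary. -/
theorem mem_frontier (h : IsMetricProj C π) {x : E} (hx : x ∉ interior C) :
    π x ∈ frontier C := by
  refine ⟨subset_closure (h.mem x), fun hi => ?_⟩
  by_cases hxe : x = π x
  · rw [← hxe] at hi
    exact hx hi
  · obtain ⟨ε, hε, hb⟩ := Metric.isOpen_iff.1 isOpen_interior _ hi
    have hn : 0 < ‖x - π x‖ := norm_pos_iff.2 (sub_ne_zero.2 hxe)
    set t : ℝ := ε / 2 / ‖x - π x‖ with ht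
    have htp : 0 < t := by positivity
    have hmem : π x + t • (x - π x) ∈ C := by
      apply interior_subset
      apply hb
      rw [mem_ball, dist_eq_norm, add_sub_cancel_left, norm_smul, Real.norm_eq_abs,
        abs_of_pos htp, ht, div_mul_cancel₀ _ hn.ne']
      linarith
    have := (h x).2 _ hmem
    rw [add_sub_cancel_left, inner_smul_right, real_inner_self_eq_norm_sq] at this
    have : 0 < t * ‖x - π x‖ ^ 2 := by positivity
    linarith

/-- A boundary point of `C` is the projection of a boundary point of any compact set that
contains `C`. -/
theorem exists_mem_frontier_of_subset [CompleteSpace E] (h : IsMetricProj C π) {K : Set E}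
    (hconv : Convex ℝ C) (hcl : IsClosed C) (hint : (interior C).Nonempty) (hCK : C ⊆ K)
    (hK : Bornology.IsBounded K) {x : E} (hx : x ∈ frontier C) :
    ∃ p ∈ frontier K, π p = x := by
  have hxC : x ∈ C := hcl.closure_eq ▸ hx.1
  obtain ⟨f, hf⟩ := geometric_hahn_banach_open_point hconv.interior isOpen_interior hx.2
  have hfle : ∀ y ∈ C, f y ≤ f x := by
    intro y hy
    have hy' : y ∈ closure (interior C) := by
      rw [hconv.closure_interior_eq_closure_of_nonempty_interior hint]
      exact subset_closure hy
    exact closure_minimal (fun a ha => (hf a ha).le)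
      (isClosed_le f.continuous continuous_const) hy'
  obtain ⟨a, ha⟩ := hint
  set ν : E := (InnerProductSpace.toDual ℝ E).symm f with hν
  have hνf : ∀ y, inner ℝ ν y = f y := fun y => by
    rw [hν, InnerProductSpace.toDual_symm_apply]
  have hν0 : ν ≠ 0 := by
    intro h0
    have h1 := hf a ha
    rw [← hνf, ← hνf, h0, inner_zero_left, inner_zero_left] at h1
    exact lt_irrefl _ h1
  -- `ν` is an outer normal at `x`, so the whole normal ray projects to `x`; the ray leaves the
  -- bounded set `K`, and its crossing of `frontier K` is the required point.
  have hproj : ∀ s : ℝ, 0 ≤ s → π (x + s • ν) = x := by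
    intro s hs
    refine h.eq_of_forall_inner_le hxC fun y hy => ?_
    rw [add_sub_cancel_left, real_inner_smul_left, inner_sub_right, hνf, hνf]
    exact mul_nonpos_of_nonneg_of_nonpos hs (by linarith [hfle y hy])
  let ray : Set E := (fun s : ℝ => x + s • ν) '' Ici 0
  have hray : IsPreconnected ray :=
    isPreconnected_Ici.image _ (by fun_prop)
  have hfr : (ray ∩ frontier K).Nonempty := by
    refine exists_mem_frontier_of_isPreconnected hray ⟨x, ⟨0, by simp, by simp⟩, hCK hxC⟩ ?_
    obtain ⟨R, hR⟩ := hK.subset_closedBall x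
    have hn : 0 < ‖ν‖ := norm_pos_iff.2 hν0
    refine ⟨x + ((|R| + 1) / ‖ν‖) • ν, ⟨_, mem_Ici.2 (by positivity), rfl⟩, fun hm => ?_⟩
    have := hR hm
    rw [mem_closedBall, dist_eq_norm, add_sub_cancel_left, norm_smul, Real.norm_eq_abs,
      abs_of_nonneg (by positivity), div_mul_cancel₀ _ hn.ne'] at this
    linarith [le_abs_self R]
  obtain ⟨p, ⟨s, hs, rfl⟩, hp⟩ := hfr
  exact ⟨_, hp, hproj s hs⟩

end IsMetricProj

end Projection

/-! ### Lengths of paths -/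

section Length

variable {X Y : Type*} [PseudoEMetricSpace X] [PseudoEMetricSpace Y]

/-- A continuous path that maps the path `γ` by a function continuous on its range. -/
theorem exists_path_comp_le {p q : X} (γ : Path p q) {A : Set X} (hγ : ∀ t, γ t ∈ A) {f : X → Y}
    {C : ℝ≥0} (hf : LipschitzOnWith C f A) :
    ∃ γ' : Path (f p) (f q), (∀ t, γ' t = f (γ t)) ∧
      eVariationOn γ' univ ≤ C * eVariationOn γ univ := by
  refine ⟨⟨⟨fun t => f (γ t), ?_⟩, by simp, by simp⟩, fun t => rfl, ?_⟩
  · exact hf.continuousOn.comp_continuous γ.continuous hγ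
  · exact hf.comp_eVariationOn_le (fun t _ => hγ t)

theorem edist_add_edist_le_eVariationOn_path {p q : X} (γ : Path p q) (t : unitInterval) :
    edist p (γ t) + edist (γ t) q ≤ eVariationOn γ univ := by
  have h0 := eVariationOn.edist_le γ (s := Icc 0 t) (x := 0) (y := t) ⟨le_rfl, t.2.1⟩
    ⟨t.2.1, le_rfl⟩
  have h1 := eVariationOn.edist_le γ (s := Icc t 1) (x := t) (y := 1) ⟨le_rfl, t.2.2⟩
    ⟨t.2.2, le_rfl⟩
  have h2 := eVariationOn.add_le_union γ (s := Icc 0 t) (t := Icc t 1)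
    (fun x hx y hy => hx.2.trans hy.1)
  rw [γ.source] at h0
  rw [γ.target] at h1
  exact (add_le_add h0 h1).trans (h2.trans (eVariationOn.mono _ (subset_univ _)))

theorem eVariationOn_path_trans_le {p q r : X} (γ : Path p q) (γ' : Path q r) :
    eVariationOn (γ.trans γ') univ ≤ eVariationOn γ univ + eVariationOn γ' univ := by
  set h : unitInterval := ⟨1 / 2, by constructor <;> norm_num⟩
  have hu : (univ : Set unitInterval) = Icc 0 h ∪ Icc h 1 := by
    ext t
    simp only [mem_univ, mem_union, mem_Icc, true_iff]
    rcases le_total t h with ht | ht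
    · exact Or.inl ⟨t.2.1, ht⟩
    · exact Or.inr ⟨ht, t.2.2⟩
  have h0 : (0 : unitInterval) ≤ h := h.2.1
  have h1 : h ≤ (1 : unitInterval) := h.2.2
  conv_lhs => rw [hu]
  rw [eVariationOn.union (γ.trans γ') (isGreatest_Icc h0) (isLeast_Icc h1)]
  refine add_le_add ?_ ?_
  · have e : EqOn (γ.trans γ')
        (γ ∘ fun t : unitInterval => projIcc (0 : ℝ) 1 zero_le_one (2 * (t : ℝ))) (Icc 0 h) := by
      intro t ht
      have ht2 : (t : ℝ) ≤ 1 / 2 := ht.2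
      rw [Path.trans_apply, dif_pos ht2, Function.comp_apply]
      congr 1
      rw [projIcc_of_mem zero_le_one ⟨by linarith [t.2.1], by linarith⟩]
    rw [eVariationOn.congr e]
    refine eVariationOn.comp_le_of_monotoneOn _ _ (fun a _ b _ hab => ?_) (fun _ _ => mem_univ _)
    exact monotone_projIcc zero_le_one (by have : (a : ℝ) ≤ b := hab; linarith)
  · have e : EqOn (γ.trans γ')
        (γ' ∘ fun t : unitInterval => projIcc (0 : ℝ) 1 zero_le_one (2 * (t : ℝ) - 1))
        (Icc h 1) := by
      intro t ht
      have ht2 : 1 / 2 ≤ (t : ℝ) := ht.1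
      have ht1 : (t : ℝ) ≤ 1 := ht.2
      rw [Function.comp_apply, projIcc_of_mem zero_le_one ⟨by linarith, by linarith⟩,
        Path.trans_apply]
      -- At `t = 1 / 2` the concatenation uses the first path, while the formula on this half uses
      -- the second; both give `q`.
      split_ifs with h2
      · have h3 : (t : ℝ) = 1 / 2 := le_antisymm h2 ht2
        trans q
        · exact (congrArg γ (Subtype.ext (by simp [h3]))).trans γ.target
        · exact γ'.source.symm.trans (congrArg γ' (Subtype.ext (by simp [h3])))
      · rfl
    rw [eVariationOn.congr e]
    refine eVariationOn.comp_le_of_monotoneOn _ _ (fun a _ b _ hab => ?_) (fun _ _ => mem_univ _)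
    exact monotone_projIcc zero_le_one (by have : (a : ℝ) ≤ b := hab; linarith)

end Length

section Segment

variable {E : Type*} [NormedAddCommGroup E] [NormedSpace ℝ E]

theorem exists_path_segment (p q : E) : ∃ γ : Path p q, (∀ t, γ t ∈ segment ℝ p q) ∧
    eVariationOn γ univ ≤ edist p q := by
  refine ⟨⟨⟨fun t => AffineMap.lineMap p q (t : ℝ), ?_⟩, by simp, by simp⟩, fun t => ?_, ?_⟩
  · fun_prop
  · rw [segment_eq_image_lineMap]
    exact ⟨t, t.2, rfl⟩
  · have hl : LipschitzWith (nndist p q) (fun t : ℝ => AffineMap.lineMap p q t : ℝ → E) :=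
      LipschitzWith.of_dist_le_mul fun s t => by
        rw [dist_lineMap_lineMap, coe_nndist, mul_comm]
    have h1 := (hl.lipschitzOnWith (s := univ)).comp_eVariationOn_le
      (f := fun t : ℝ => (AffineMap.lineMap p q t : E))
      (g := fun t : unitInterval => (t : ℝ)) (s := univ) (fun _ _ => mem_univ _)
    have h2 : eVariationOn (fun t : unitInterval => (t : ℝ)) univ ≤ 1 := by
      have := MonotoneOn.eVariationOn_eq (f := fun t : unitInterval => (t : ℝ)) (s := univ)
        (a := 0) (b := 1) (fun _ _ _ _ h => h) (mem_univ _) (mem_univ _)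
      rw [univ_inter] at this
      have hu : (Icc 0 1 : Set unitInterval) = univ := by
        exact eq_univ_of_forall fun t => ⟨t.2.1, t.2.2⟩
      rw [hu] at this
      exact le_of_eq (by simpa using this)
    refine h1.trans ?_
    calc _ ≤ (nndist p q : ℝ≥0∞) * 1 := by gcongr
      _ = edist p q := by rw [mul_one, edist_nndist]

end Segment

/-! ### Intrinsic distance and distortion -/

section Intrinsic

variable {A : Set E3} {p q r : E3}

theorem intrinsicEDist_le (γ : Path p q) (hγ : ∀ t, γ t ∈ A) :
    intrinsicEDist A p q ≤ eVariationOn γ univ :=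
  iInf₂_le γ hγ

theorem exists_path_of_intrinsicEDist_lt {c : ℝ≥0∞} (h : intrinsicEDist A p q < c) :
    ∃ γ : Path p q, (∀ t, γ t ∈ A) ∧ eVariationOn γ univ < c := by
  simpa only [intrinsicEDist, iInf_lt_iff, exists_prop] using h

theorem intrinsicEDist_comm : intrinsicEDist A p q = intrinsicEDist A q p := by
  have key : ∀ p q : E3, intrinsicEDist A q p ≤ intrinsicEDist A p q := by
    intro p q
    refine le_iInf₂ fun γ hγ => ?_
    refine (intrinsicEDist_le γ.symm fun t => hγ _).trans ?_
    refine eVariationOn.comp_le_of_antitoneOn γ unitInterval.symm (t := univ) ?_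
      (fun _ _ => mem_univ _)
    intro a _ b _ hab
    exact unitInterval.symm_le_symm.2 hab
  exact le_antisymm (key q p) (key p q)

theorem intrinsicEDist_triangle :
    intrinsicEDist A p r ≤ intrinsicEDist A p q + intrinsicEDist A q r := by
  refine ENNReal.le_of_forall_pos_le_add fun ε hε hlt => ?_
  have hε2 : (0 : ℝ≥0∞) < ε / 2 := by simpa using hε.ne'
  have h1 : intrinsicEDist A p q < ⊤ := lt_of_le_of_lt le_self_add hlt
  have h2 : intrinsicEDist A q r < ⊤ := lt_of_le_of_lt le_add_self hlt
  obtain ⟨γ, hγ, hγl⟩ := exists_path_of_intrinsicEDist_lt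
    (ENNReal.lt_add_right h1.ne hε2.ne')
  obtain ⟨γ', hγ', hγl'⟩ := exists_path_of_intrinsicEDist_lt
    (ENNReal.lt_add_right h2.ne hε2.ne')
  refine (intrinsicEDist_le (γ.trans γ') fun t => ?_).trans
    ((eVariationOn_path_trans_le γ γ').trans ((add_le_add hγl.le hγl'.le).trans ?_))
  · rw [Path.trans_apply]
    split_ifs
    exacts [hγ _, hγ' _]
  · rw [add_add_add_comm, ENNReal.add_halves]

theorem intrinsicEDist_le_of_segment (h : segment ℝ p q ⊆ A) :
    intrinsicEDist A p q ≤ edist p q := by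
  obtain ⟨γ, hγ, hl⟩ := exists_path_segment p q
  exact (intrinsicEDist_le γ fun t => h (hγ t)).trans hl

theorem intrinsicEDist_map_le {B : Set E3} {f : E3 → E3} {C : ℝ≥0} (hC : C ≠ 0)
    (hf : LipschitzOnWith C f A) (hAB : MapsTo f A B) :
    intrinsicEDist B (f p) (f q) ≤ C * intrinsicEDist A p q := by
  have key : ∀ γ : Path p q, (∀ t, γ t ∈ A) →
      intrinsicEDist B (f p) (f q) ≤ C * eVariationOn γ univ := by
    intro γ hγ
    obtain ⟨γ', h1, h2⟩ := exists_path_comp_le γ hγ hf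
    exact (intrinsicEDist_le γ' fun t => by rw [h1]; exact hAB (hγ t)).trans h2
  simp_rw [intrinsicEDist, ENNReal.mul_iInf_of_ne (ENNReal.coe_ne_zero.2 hC) ENNReal.coe_ne_top]
  exact le_iInf₂ key

theorem intrinsicEDist_le_of_distortion_le {κ : ℝ≥0∞} (h : distortion A ≤ κ) (hp : p ∈ A)
    (hq : q ∈ A) (hpq : p ≠ q) : intrinsicEDist A p q ≤ κ * edist p q := by
  have h1 : intrinsicEDist A p q / edist p q ≤ κ :=
    (le_iSup₂_of_le (f := fun p (_ : p ∈ A) => ⨆ (q ∈ A) (_ : p ≠ q),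
      intrinsicEDist A p q / edist p q) p hp (le_iSup₂_of_le q hq
        (le_iSup (fun _ : p ≠ q => intrinsicEDist A p q / edist p q) hpq))).trans h
  rwa [ENNReal.div_le_iff (edist_pos.2 hpq).ne' (edist_ne_top _ _)] at h1

theorem distortion_le {κ : ℝ≥0∞}
    (h : ∀ p ∈ A, ∀ q ∈ A, p ≠ q → intrinsicEDist A p q ≤ κ * edist p q) :
    distortion A ≤ κ := by
  refine iSup₂_le fun p hp => iSup₂_le fun q hq => iSup_le fun hpq => ?_
  rw [ENNReal.div_le_iff (edist_pos.2 hpq).ne' (edist_ne_top _ _)]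
  exact h p hp q hq hpq

end Intrinsic

/-! ### Arc length of Lipschitz curves -/

section Variation

variable {E : Type*} [PseudoMetricSpace E] {γ : ℝ → E} {C : ℝ≥0}

theorem ofReal_variationOnFromTo (hγ : LipschitzWith C γ) {a b : ℝ} (hab : a ≤ b) :
    ENNReal.ofReal (variationOnFromTo γ univ a b) = eVariationOn γ (Icc a b) := by
  rw [variationOnFromTo.eq_of_le γ univ hab, univ_inter, ENNReal.ofReal_toReal]
  have := (hγ.locallyBoundedVariationOn univ) a b (mem_univ _) (mem_univ _)
  rwa [univ_inter] at this

theorem dist_le_variationOnFromTo (hγ : LipschitzWith C γ) {a b : ℝ} (hab : a ≤ b) :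
    dist (γ a) (γ b) ≤ variationOnFromTo γ univ a b := by
  have h := eVariationOn.edist_le γ (left_mem_Icc.2 hab) (right_mem_Icc.2 hab)
  rwa [← ofReal_variationOnFromTo hγ hab, edist_dist,
    ENNReal.ofReal_le_ofReal_iff (variationOnFromTo.nonneg_of_le γ univ hab)] at h

theorem variationOnFromTo_add (hγ : LipschitzWith C γ) (a b c : ℝ) :
    variationOnFromTo γ univ a b + variationOnFromTo γ univ b c
      = variationOnFromTo γ univ a c :=
  variationOnFromTo.add (hγ.locallyBoundedVariationOn univ) (mem_univ _) (mem_univ _) (mem_univ _)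

theorem continuous_variationOnFromTo (hγ : LipschitzWith C γ) (a : ℝ) :
    Continuous (variationOnFromTo γ univ a) := by
  have key : ∀ s t : ℝ, s ≤ t →
      variationOnFromTo γ univ a t - variationOnFromTo γ univ a s ≤ C * (t - s) := by
    intro s t hst
    have h := (hγ.lipschitzOnWith (s := univ)).comp_eVariationOn_le (g := (id : ℝ → ℝ))
      (s := Icc s t) (fun _ _ => mem_univ _)
    rw [Function.comp_id, eVariationOn_id_Icc, ← ofReal_variationOnFromTo hγ hst,
      ← ENNReal.ofReal_coe_nnreal, ← ENNReal.ofReal_mul C.coe_nonneg,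
      ENNReal.ofReal_le_ofReal_iff (mul_nonneg C.coe_nonneg (by linarith))] at h
    linarith [variationOnFromTo_add hγ a s t]
  have hmono := variationOnFromTo.monotoneOn (hγ.locallyBoundedVariationOn univ) (mem_univ a)
  refine (LipschitzWith.of_dist_le_mul (K := C) fun s t => ?_).continuous
  rw [Real.dist_eq, Real.dist_eq]
  rcases le_total s t with h | h
  · rw [abs_sub_comm, abs_sub_comm s t, abs_of_nonneg (sub_nonneg.2 h),
      abs_of_nonneg (sub_nonneg.2 (hmono (mem_univ _) (mem_univ _) h))]
    exact key s t h
  · rw [abs_of_nonneg (sub_nonneg.2 h),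
      abs_of_nonneg (sub_nonneg.2 (hmono (mem_univ _) (mem_univ _) h))]
    exact key t s h

theorem variationOnFromTo_add_period {P : ℝ} (hP : Function.Periodic γ P) (a b : ℝ)
    (hab : a ≤ b) :
    variationOnFromTo γ univ (a + P) (b + P) = variationOnFromTo γ univ a b := by
  rw [variationOnFromTo.eq_of_le γ univ hab,
    variationOnFromTo.eq_of_le γ univ (by linarith : a + P ≤ b + P), univ_inter, univ_inter]
  congr 1
  have h := eVariationOn.comp_eq_of_monotoneOn γ (t := Icc a b) (fun x => x + P)
    (fun x _ y _ h => by simpa using h)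
  rw [image_add_const_Icc] at h
  rw [← h]
  congr 1
  ext x
  exact hP x

/-- A reparametrisation that sweeps an interval costs at least the variation on that interval. -/
theorem eVariationOn_Icc_le_comp {E : Type*} [PseudoEMetricSpace E] (γ : ℝ → E) {a : ℝ → ℝ}
    (ha : ContinuousOn a (Icc 0 1)) {α β : ℝ} (h0 : a 0 ≤ α) (h1 : β ≤ a 1) :
    eVariationOn γ (Icc α β) ≤ eVariationOn (γ ∘ a) (Icc 0 1) := by
  -- The first time `τ θ` at which `a` reaches level `θ` is a monotone right inverse of `a`, so `γ`
  -- is a monotone reparametrisation of `γ ∘ a`.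
  have hex : ∀ θ ∈ Icc α β, ∃ t, IsLeast (Icc 0 1 ∩ {t | θ ≤ a t}) t := by
    intro θ hθ
    have hcl : IsClosed (Icc (0 : ℝ) 1 ∩ {t | θ ≤ a t}) :=
      ha.preimage_isClosed_of_isClosed isClosed_Icc isClosed_Ici
    exact (isCompact_Icc.of_isClosed_subset hcl inter_subset_left).exists_isLeast
      ⟨1, ⟨by simp, hθ.2.trans h1⟩⟩
  choose! τ hτ using hex
  have hval : ∀ θ ∈ Icc α β, a (τ θ) = θ := by
    intro θ hθ
    obtain ⟨⟨hm, hle⟩, hmin⟩ := hτ θ hθ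
    refine le_antisymm ?_ hle
    by_contra! hlt
    have hsub : Icc 0 (τ θ) ⊆ Icc (0 : ℝ) 1 := Icc_subset_Icc_right hm.2
    obtain ⟨t, ht, hta⟩ := intermediate_value_Icc hm.1 (ha.mono hsub)
      (⟨h0.trans hθ.1, hlt.le⟩ : θ ∈ Icc (a 0) (a (τ θ)))
    have := hmin ⟨hsub ht, hta.ge⟩
    have : t = τ θ := le_antisymm ht.2 this
    rw [← this, hta] at hlt
    exact lt_irrefl _ hlt
  have hmono : MonotoneOn τ (Icc α β) := by
    intro x hx y hy hxy
    exact (hτ x hx).2 ⟨(hτ y hy).1.1, hxy.trans (hτ y hy).1.2⟩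
  calc eVariationOn γ (Icc α β) = eVariationOn ((γ ∘ a) ∘ τ) (Icc α β) :=
        eVariationOn.congr fun θ hθ => by simp [hval θ hθ]
    _ ≤ _ := eVariationOn.comp_le_of_monotoneOn _ _ hmono fun θ hθ => (hτ θ hθ).1.1

end Variation

/-! ### Radial parametrisation of planar convex curves -/

section BoundaryCurve

/-- The radial parametrisation of the boundary of a planar convex body around the origin. -/
noncomputable def boundaryCurve (S : Set ℂ) (θ : ℝ) : ℂ :=
  (gauge S (Circle.exp θ))⁻¹ • (Circle.exp θ : ℂ)

theorem dist_circleExp_le (s t : ℝ) : ‖(Circle.exp s : ℂ) - Circle.exp t‖ ≤ |s - t| := by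
  have h : (Circle.exp s : ℂ) - Circle.exp t
      = Circle.exp t * (Complex.exp (Complex.I * ((s - t : ℝ) : ℂ)) - 1) := by
    rw [Circle.coe_exp, Circle.coe_exp, mul_sub, ← Complex.exp_add]
    push_cast
    ring_nf
  rw [h, norm_mul, Circle.norm_coe, one_mul]
  exact Real.norm_exp_I_mul_ofReal_sub_one_le

variable {S : Set ℂ}

theorem boundaryCurve_periodic : Function.Periodic (boundaryCurve S) (2 * Real.pi) := by
  intro θ
  rw [boundaryCurve, Circle.exp_add_two_pi, boundaryCurve]

theorem gauge_circle_pos (hb : Bornology.IsBounded S) (h0 : S ∈ nhds 0) (u : Circle) :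
    0 < gauge S (u : ℂ) :=
  (gauge_pos (absorbent_nhds_zero h0) ((NormedSpace.isVonNBounded_iff ℝ).2 hb)).2 u.coe_ne_zero

theorem boundaryCurve_mem_frontier (hc : Convex ℝ S) (hb : Bornology.IsBounded S)
    (h0 : S ∈ nhds 0) (θ : ℝ) : boundaryCurve S θ ∈ frontier S := by
  have hp := gauge_circle_pos hb h0 (Circle.exp θ)
  rw [← gauge_eq_one_iff_mem_frontier hc h0, boundaryCurve,
    gauge_smul_of_nonneg (inv_nonneg.2 hp.le), smul_eq_mul, inv_mul_cancel₀ hp.ne']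

theorem eq_boundaryCurve_of_mem_frontier (hc : Convex ℝ S) (h0 : S ∈ nhds 0) {z : ℂ}
    (hz : z ∈ frontier S) {θ : ℝ} (hθ : z = ‖z‖ • (Circle.exp θ : ℂ)) :
    z = boundaryCurve S θ := by
  have h1 := (gauge_eq_one_iff_mem_frontier hc h0).2 hz
  rw [hθ, gauge_smul_of_nonneg (norm_nonneg _), smul_eq_mul] at h1
  rw [boundaryCurve, ← eq_inv_of_mul_eq_one_left h1]
  exact hθ

/-- The gauge is Lipschitz, and on the unit circle it is at least `1 / R` when `S` lies in the ball
of radius `R`; hence its reciprocal is Lipschitz there. -/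
theorem exists_lipschitzWith_boundaryCurve (hc : Convex ℝ S) (hb : Bornology.IsBounded S)
    (h0 : S ∈ nhds 0) : ∃ C : ℝ≥0, LipschitzWith C (boundaryCurve S) := by
  obtain ⟨K, hK⟩ := hc.lipschitz_gauge h0
  obtain ⟨R, hR, hRS⟩ := hb.subset_closedBall_lt 0 0
  have hG : ∀ θ, (gauge S (Circle.exp θ : ℂ))⁻¹ ≤ R := by
    intro θ
    have := le_gauge_of_subset_closedBall (absorbent_nhds_zero h0) hR.le hRS
      (x := (Circle.exp θ : ℂ))
    rw [Circle.norm_coe] at this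
    rw [inv_le_comm₀ (gauge_circle_pos hb h0 _) hR, ← one_div]
    exact this
  refine ⟨⟨R + R * (R * K), by positivity⟩, LipschitzWith.of_dist_le_mul fun s t => ?_⟩
  have hs := gauge_circle_pos hb h0 (Circle.exp s)
  have ht := gauge_circle_pos hb h0 (Circle.exp t)
  have hd := dist_circleExp_le s t
  have hgd : |gauge S (Circle.exp s : ℂ) - gauge S (Circle.exp t : ℂ)| ≤ K * |s - t| := by
    rw [← Real.dist_eq]
    refine (hK.dist_le_mul _ _).trans ?_
    rw [dist_eq_norm]
    gcongr
  set a := gauge S (Circle.exp s : ℂ)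
  set b := gauge S (Circle.exp t : ℂ)
  have e : boundaryCurve S s - boundaryCurve S t
      = a⁻¹ • ((Circle.exp s : ℂ) - Circle.exp t) + (a⁻¹ * (b⁻¹ * (b - a))) •
        (Circle.exp t : ℂ) := by
    have : a⁻¹ * (b⁻¹ * (b - a)) = a⁻¹ - b⁻¹ := by
      field_simp
    rw [this, sub_smul, smul_sub]
    simp only [boundaryCurve]
    abel
  rw [dist_eq_norm, e, Real.dist_eq]
  refine (norm_add_le _ _).trans ?_
  rw [norm_smul, norm_smul, Circle.norm_coe, mul_one, norm_mul, norm_mul, Real.norm_eq_abs,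
    Real.norm_eq_abs, Real.norm_eq_abs, abs_of_pos (inv_pos.2 hs), abs_of_pos (inv_pos.2 ht),
    abs_sub_comm b a]
  have hsR := hG s
  have htR := hG t
  have hs' := inv_pos.2 hs
  have ht' := inv_pos.2 ht
  calc a⁻¹ * ‖(Circle.exp s : ℂ) - Circle.exp t‖ + a⁻¹ * (b⁻¹ * |a - b|)
      ≤ R * |s - t| + R * (R * (K * |s - t|)) := by gcongr
    _ = (R + R * (R * K)) * |s - t| := by ring
    _ = _ := rfl

/-- A path in the boundary of a planar convex body is a reparametrisation of the boundary
curve. -/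
theorem exists_lift_of_path_mem_frontier (hc : Convex ℝ S) (h0 : S ∈ nhds 0) {α : ℝ} {x y : ℂ}
    (σ : Path x y) (hσ : ∀ t, σ t ∈ frontier S) (hx : x = boundaryCurve S α)
    (hb : Bornology.IsBounded S) :
    ∃ a : C(unitInterval, ℝ), a 0 = α ∧ ∀ t, σ t = boundaryCurve S (a t) := by
  have hne : ∀ t, σ t ≠ 0 := by
    intro t ht
    have := (hσ t).2
    rw [ht] at this
    exact this (mem_interior_iff_mem_nhds.2 h0)
  have hmem : ∀ t, σ t / ‖σ t‖ ∈ Submonoid.unitSphere ℂ := by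
    intro t
    rw [Submonoid.unitSphere]
    simp [hne t]
  let u : C(unitInterval, Circle) := ⟨fun t => ⟨σ t / ‖σ t‖, hmem t⟩, by
    refine Continuous.subtype_mk ?_ _
    refine Continuous.div σ.continuous (by fun_prop) fun t => ?_
    simpa using hne t⟩
  have hu : ∀ t, (u t : ℂ) = σ t / ‖σ t‖ := fun t => rfl
  have hu0 : u 0 = Circle.exp α := by
    apply Circle.ext
    rw [hu, σ.source, hx, boundaryCurve, norm_smul, Circle.norm_coe, mul_one, norm_inv,
      Real.norm_eq_abs, abs_of_nonneg (gauge_nonneg _), Complex.real_smul,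
      mul_comm, mul_div_assoc, div_self, mul_one]
    have := gauge_circle_pos hb h0 (Circle.exp α)
    simpa using this.ne'
  obtain ⟨a, ha, ha0⟩ := Circle.isCoveringMap_exp.exists_path_lifts u α hu0
  refine ⟨a, ha0, fun t => eq_boundaryCurve_of_mem_frontier hc h0 (hσ t) ?_⟩
  have h2 : Circle.exp (a t) = u t := congrFun ha t
  have hn : (‖σ t‖ : ℂ) ≠ 0 := by simpa using hne t
  rw [h2, hu, Complex.real_smul, mul_div_cancel₀ _ hn]

/-- The angular lift of the path starts at `α` and ends at `β + 2πk`. For `k ≥ 0` it sweeps `[α,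
β]`; for `k ≤ -1` it runs back at least to `β - 2π` and sweeps `[β - 2π, α]`. -/
theorem min_le_eVariationOn_of_mem_frontier (hc : Convex ℝ S) (h0 : S ∈ nhds 0)
    (hb : Bornology.IsBounded S) {α β : ℝ} {x y : ℂ} (σ : Path x y)
    (hσ : ∀ t, σ t ∈ frontier S) (hx : x = boundaryCurve S α) (hy : y = boundaryCurve S β) :
    min (eVariationOn (boundaryCurve S) (Icc α β))
      (eVariationOn (boundaryCurve S) (Icc (β - 2 * Real.pi) α)) ≤ eVariationOn σ univ := by
  obtain ⟨a, ha0, ha⟩ := exists_lift_of_path_mem_frontier hc h0 σ hσ hx hb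
  obtain ⟨k, hk⟩ : ∃ k : ℤ, a 1 = β + k * (2 * Real.pi) := by
    rw [← Circle.exp_eq_exp]
    have h1 : boundaryCurve S (a 1) = boundaryCurve S β := by rw [← ha, σ.target, hy]
    have h2 := congrArg (fun z : ℂ => z / ‖z‖) h1
    have h3 : ∀ θ, boundaryCurve S θ / ‖boundaryCurve S θ‖ = Circle.exp θ := by
      intro θ
      have := gauge_circle_pos hb h0 (Circle.exp θ)
      rw [boundaryCurve, norm_smul, Circle.norm_coe, mul_one, norm_inv,
        Real.norm_eq_abs, abs_of_pos this, Complex.real_smul,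
        mul_comm, mul_div_assoc, div_self, mul_one]
      simpa using this.ne'
    simp only [h3] at h2
    exact Circle.ext h2
  have hpi := Real.pi_pos
  have hcont : ∀ φ : ℝ → ℝ, Continuous φ →
      ContinuousOn (fun t => a (projIcc 0 1 zero_le_one (φ t))) (Icc (0 : ℝ) 1) := by
    intro φ hφ
    exact (a.continuous.comp (continuous_projIcc.comp hφ)).continuousOn
  rcases le_or_gt 0 k with hk0 | hk0
  · refine (min_le_left _ _).trans ?_
    have hk0' : (0 : ℝ) ≤ k := by exact_mod_cast hk0
    refine (eVariationOn_Icc_le_comp (boundaryCurve S) (hcont id continuous_id)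
      (by simp [ha0]) (by simp [hk]; positivity)).trans ?_
    have e : (boundaryCurve S ∘ fun t => a (projIcc 0 1 zero_le_one (id t)))
        = σ ∘ projIcc (0 : ℝ) 1 zero_le_one := by
      ext t
      simp [ha]
    rw [e]
    exact eVariationOn.comp_le_of_monotoneOn _ _
      ((monotone_projIcc zero_le_one).monotoneOn _) fun _ _ => mem_univ _
  · refine (min_le_right _ _).trans ?_
    have hk0' : (k : ℝ) ≤ -1 := by exact_mod_cast Int.le_sub_one_of_lt hk0
    refine (eVariationOn_Icc_le_comp (boundaryCurve S)
      (hcont (fun t => 1 - t) (by fun_prop)) ?_ ?_).trans ?_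
    · simp [hk]
      nlinarith
    · simp [ha0]
    have e : (boundaryCurve S ∘ fun t => a (projIcc 0 1 zero_le_one (1 - t)))
        = σ ∘ fun t : ℝ => projIcc (0 : ℝ) 1 zero_le_one (1 - t) := by
      ext t
      simp [ha]
    rw [e]
    exact eVariationOn.comp_le_of_antitoneOn _ _
      (fun s _ t _ hst => monotone_projIcc zero_le_one (by linarith)) fun _ _ => mem_univ _

end BoundaryCurve

/-! ### Short chords that halve the perimeter of a planar convex curve -/

section Antipodal

/-- A sequence of vectors from `g 0` to `- g 0` with norms at least `m` has a step of length at
least `2 m sin (π / 2n)`. -/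
theorem exists_step_of_antipodal {V : Type*} [NormedAddCommGroup V] [InnerProductSpace ℝ V]
    {n : ℕ} (hn : 0 < n) (g : ℕ → V) (hg : g n = -g 0) {m : ℝ} (hm : 0 < m)
    (hgm : ∀ i ≤ n, m ≤ ‖g i‖) :
    ∃ i < n, 2 * m * Real.sin (Real.pi / (2 * n)) ≤ ‖g (i + 1) - g i‖ := by
  have hn' : (0 : ℝ) < n := by exact_mod_cast hn
  have hsum : ∀ k, InnerProductGeometry.angle (g 0) (g k) ≤
      InnerProductGeometry.angle (g 0) (g 0) +
      ∑ i ∈ Finset.range k, InnerProductGeometry.angle (g i) (g (i + 1)) := by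
    intro k
    induction k with
    | zero => simp
    | succ k ih =>
      rw [Finset.sum_range_succ]
      have := InnerProductGeometry.angle_le_angle_add_angle (g 0) (g k) (g (k + 1))
      linarith
  have hg0 : g 0 ≠ 0 := by
    intro h
    have := hgm 0 (Nat.zero_le _)
    rw [h, norm_zero] at this
    linarith
  have hπ := hsum n
  rw [hg, InnerProductGeometry.angle_self_neg_of_nonzero hg0,
    InnerProductGeometry.angle_self hg0, zero_add] at hπ
  obtain ⟨i, hi, hia⟩ : ∃ i ∈ Finset.range n,
      Real.pi / n ≤ InnerProductGeometry.angle (g i) (g (i + 1)) := by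
    by_contra! hlt
    have := Finset.sum_lt_sum_of_nonempty ⟨0, Finset.mem_range.2 hn⟩ hlt
    rw [Finset.sum_const, Finset.card_range, nsmul_eq_mul, mul_div_cancel₀ _ hn'.ne'] at this
    linarith
  rw [Finset.mem_range] at hi
  refine ⟨i, hi, ?_⟩
  have ha := hgm i hi.le
  have hb := hgm (i + 1) hi
  set φ := InnerProductGeometry.angle (g i) (g (i + 1)) with hφ
  have hcos := norm_sub_sq_real (g (i + 1)) (g i)
  rw [real_inner_comm, ← InnerProductGeometry.cos_angle_mul_norm_mul_norm, ← hφ] at hcos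
  have hφπ : φ ≤ Real.pi := InnerProductGeometry.angle_le_pi _ _
  have hs : Real.sin (Real.pi / (2 * n)) ≤ Real.sin (φ / 2) := by
    refine Real.sin_le_sin_of_le_of_le_pi_div_two ?_ (by linarith) ?_
    · have : 0 ≤ Real.pi / (2 * n) := by positivity
      linarith [Real.pi_pos]
    · rw [mul_comm, ← div_div]
      linarith
  have hs0 : 0 ≤ Real.sin (Real.pi / (2 * n)) := by
    refine Real.sin_nonneg_of_nonneg_of_le_pi (by positivity) ?_
    rw [div_le_iff₀ (by positivity)]
    have : (1 : ℝ) ≤ n := by exact_mod_cast hn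
    nlinarith [Real.pi_pos]
  have hhalf : Real.cos φ = 1 - 2 * Real.sin (φ / 2) ^ 2 := by
    have := Real.cos_sq' (φ / 2)
    have h2 := Real.cos_two_mul (φ / 2)
    rw [mul_div_cancel₀ _ (two_ne_zero)] at h2
    linarith
  refine le_of_sq_le_sq ?_ (norm_nonneg _)
  rw [hcos, hhalf]
  set a := ‖g i‖
  set b := ‖g (i + 1)‖
  set s := Real.sin (φ / 2)
  set s0 := Real.sin (Real.pi / (2 * n))
  have hss : s0 ^ 2 ≤ s ^ 2 := by gcongr
  have hab : m * m ≤ a * b := by gcongr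
  have hm2 : m * m * s0 ^ 2 ≤ a * b * s ^ 2 := by gcongr
  nlinarith [sq_nonneg (a - b)]

end Antipodal

section HalfPerimeter

variable {S : Set ℂ}

/-- Divide the boundary into `2n` arcs of equal length and consider the `n + 1` chords joining
division points `n` arcs apart. As vectors they run from the first chord to its negative, so if the
shortest has length `m`, some step between consecutive chords is at least `2 m sin (π / 2n)`. Each
step is the difference of two displacements along arcs of length `L / 2n`, hence at most `L / n`. -/
theorem exists_halving_pair_of_mem_nhds (hc : Convex ℝ S) (hb : Bornology.IsBounded S)
    (h0 : S ∈ nhds 0) {n : ℕ} (hn : 0 < n) :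
    ∃ x ∈ frontier S, ∃ y ∈ frontier S, ∃ L : ℝ, 0 < L ∧
      2 * n * Real.sin (Real.pi / (2 * n)) * ‖x - y‖ ≤ L ∧
      (∀ σ : Path x y, (∀ t, σ t ∈ frontier S) → ENNReal.ofReal (L / 2) ≤ eVariationOn σ univ) ∧
      ∀ s ∈ S, ‖s‖ ≤ L := by
  obtain ⟨C, hC⟩ := exists_lipschitzWith_boundaryCurve hc hb h0
  have hn' : (0 : ℝ) < n := by exact_mod_cast hn
  have hpi := Real.pi_pos
  set γ := boundaryCurve S with hγ
  set ℓ : ℝ → ℝ := variationOnFromTo γ univ 0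
  set L := ℓ (2 * Real.pi) with hL
  have hadd := variationOnFromTo_add hC
  have hℓ0 : ℓ 0 = 0 := variationOnFromTo.self γ univ 0
  have hmono : Monotone ℓ := fun s t hst =>
    variationOnFromTo.monotoneOn (hC.locallyBoundedVariationOn univ) (mem_univ 0) (mem_univ _)
      (mem_univ _) hst
  have hper : ∀ θ, γ (θ + 2 * Real.pi) = γ θ := boundaryCurve_periodic
  have hdist : ∀ s ∈ Icc 0 (2 * Real.pi), ∀ t ∈ Icc 0 (2 * Real.pi), ‖γ s - γ t‖ ≤ L := by
    have key : ∀ s ∈ Icc 0 (2 * Real.pi), ∀ t ∈ Icc 0 (2 * Real.pi), s ≤ t →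
        ‖γ s - γ t‖ ≤ L := by
      intro s hs t ht hst
      have h1 := dist_le_variationOnFromTo hC hst
      rw [dist_eq_norm] at h1
      have h2 := hadd 0 s t
      have h3 := hmono hs.1
      have h4 := hmono ht.2
      rw [hℓ0] at h3
      change ℓ s + _ = ℓ t at h2
      linarith
    intro s hs t ht
    rcases le_total s t with h | h
    · exact key s hs t ht h
    · rw [norm_sub_rev]
      exact key t ht s hs h
  have hnorm : ∀ θ, ‖γ θ‖ = (gauge S (Circle.exp θ : ℂ))⁻¹ := by
    intro θ
    rw [hγ, boundaryCurve, norm_smul, Circle.norm_coe, mul_one, norm_inv,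
      Real.norm_eq_abs, abs_of_pos (gauge_circle_pos hb h0 _)]
  -- The origin lies between boundary points in opposite directions, so the distance from the origin
  -- is bounded by a chord, and thereby by `L`.
  have hopp : ∀ θ, ‖γ θ‖ ≤ ‖γ θ - γ (θ + Real.pi)‖ := by
    intro θ
    have e : (Circle.exp (θ + Real.pi) : ℂ) = -(Circle.exp θ : ℂ) := by
      rw [Circle.coe_exp, Circle.coe_exp]
      push_cast
      rw [add_mul, Complex.exp_add, Complex.exp_pi_mul_I]
      ring
    rw [hnorm, hγ]
    simp only [boundaryCurve]
    rw [e, smul_neg, sub_neg_eq_add, ← add_smul, norm_smul, Circle.norm_coe, mul_one,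
      Real.norm_eq_abs]
    have h1 := inv_pos.2 (gauge_circle_pos hb h0 (Circle.exp θ))
    have h2 : 0 ≤ (gauge S (-(Circle.exp θ : ℂ)))⁻¹ := inv_nonneg.2 (gauge_nonneg _)
    rw [abs_of_nonneg (by positivity)]
    linarith
  have hγL : ∀ θ ∈ Ioc (-Real.pi) Real.pi, ‖γ θ‖ ≤ L := by
    intro θ hθ
    refine (hopp θ).trans ?_
    rcases le_or_gt 0 θ with h | h
    · exact hdist _ ⟨h, by linarith [hθ.2]⟩ _ ⟨by linarith, by linarith [hθ.2]⟩
    · rw [← hper θ]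
      exact hdist _ ⟨by linarith [hθ.1], by linarith⟩ _ ⟨by linarith [hθ.1], by linarith⟩
  have hLpos : 0 < L := by
    have h1 := hγL Real.pi ⟨by linarith, le_rfl⟩
    rw [hnorm] at h1
    exact lt_of_lt_of_le (inv_pos.2 (gauge_circle_pos hb h0 _)) h1
  have hSL : ∀ s ∈ S, ‖s‖ ≤ L := by
    intro s hs
    have hθ := Complex.arg_mem_Ioc s
    refine le_trans ?_ (hγL _ hθ)
    have h1 := gauge_le_one_of_mem hs
    have e : s = ‖s‖ • (Circle.exp s.arg : ℂ) := by
      rw [Circle.coe_exp, Complex.real_smul, Complex.norm_mul_exp_arg_mul_I]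
    rw [e, gauge_smul_of_nonneg (norm_nonneg _), smul_eq_mul] at h1
    rw [hnorm, ← one_div, le_div_iff₀ (gauge_circle_pos hb h0 _)]
    exact h1
  have hθex : ∀ i : ℕ, i ≤ 2 * n →
      ∃ θ ∈ Icc 0 (2 * Real.pi), ℓ θ = i * (L / (2 * n)) := by
    intro i hi
    have hi' : (i : ℝ) ≤ 2 * n := by exact_mod_cast hi
    have := intermediate_value_Icc (by positivity : (0 : ℝ) ≤ 2 * Real.pi)
      (continuous_variationOnFromTo hC 0).continuousOn
    have hmem : (i : ℝ) * (L / (2 * n)) ∈ Icc (ℓ 0) (ℓ (2 * Real.pi)) := by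
      rw [hℓ0]
      refine ⟨by positivity, ?_⟩
      rw [← hL, mul_div_assoc', div_le_iff₀ (by positivity)]
      nlinarith
    exact this hmem
  choose! θ hθ hℓθ using hθex
  have hstep : ∀ i j : ℕ, i ≤ j → j ≤ 2 * n →
      ‖γ (θ j) - γ (θ i)‖ ≤ (j - i) * (L / (2 * n)) := by
    have key : ∀ s t : ℝ, ‖γ s - γ t‖ ≤ |ℓ s - ℓ t| := by
      have key' : ∀ s t : ℝ, s ≤ t → ‖γ s - γ t‖ ≤ |ℓ s - ℓ t| := by
        intro s t hst
        have h1 := dist_le_variationOnFromTo hC hst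
        have h2 : ℓ s + _ = ℓ t := hadd 0 s t
        rw [dist_eq_norm] at h1
        rw [abs_sub_comm]
        exact (by linarith : ‖γ s - γ t‖ ≤ ℓ t - ℓ s).trans (le_abs_self _)
      intro s t
      rcases le_total s t with h | h
      · exact key' s t h
      · rw [norm_sub_rev, abs_sub_comm]
        exact key' t s h
    intro i j hij hj
    refine (key _ _).trans ?_
    rw [hℓθ j hj, hℓθ i (hij.trans hj), ← sub_mul, abs_of_nonneg]
    have : (i : ℝ) ≤ j := by exact_mod_cast hij
    exact mul_nonneg (by linarith) (by positivity)
  have hfr := boundaryCurve_mem_frontier hc hb h0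
  have hpath : ∀ i ≤ n, ∀ σ : Path (γ (θ i)) (γ (θ (i + n))), (∀ t, σ t ∈ frontier S) →
      ENNReal.ofReal (L / 2) ≤ eVariationOn σ univ := by
    intro i hi σ hσ
    refine le_trans ?_ (min_le_eVariationOn_of_mem_frontier hc h0 hb σ hσ rfl rfl)
    have hi1 : i ≤ 2 * n := by omega
    have hi2 : i + n ≤ 2 * n := by omega
    have e1 := hℓθ i hi1
    have e2 := hℓθ (i + n) hi2
    have ediff : ℓ (θ (i + n)) - ℓ (θ i) = L / 2 := by
      rw [e1, e2]
      push_cast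
      field_simp
      ring
    have hle : θ i ≤ θ (i + n) := by
      by_contra! hlt
      have := hmono hlt.le
      linarith
    refine le_min ?_ ?_
    · rw [← ofReal_variationOnFromTo hC hle]
      have h2 : ℓ (θ i) + _ = ℓ (θ (i + n)) := hadd 0 (θ i) (θ (i + n))
      exact ENNReal.ofReal_le_ofReal (by linarith)
    -- The complementary arc also has length `L / 2`: split it at angle `0` and move the negative
    -- part by one period.
    · have hm1 := hθ _ hi1
      have hm2 := hθ _ hi2
      have hle2 : θ (i + n) - 2 * Real.pi ≤ θ i := by linarith [hm1.1, hm2.2]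
      rw [← ofReal_variationOnFromTo hC hle2]
      have h2 := hadd (θ (i + n) - 2 * Real.pi) 0 (θ i)
      have h3 := variationOnFromTo_add_period (γ := γ) boundaryCurve_periodic
        (θ (i + n) - 2 * Real.pi) 0 (by linarith [hm2.2])
      rw [sub_add_cancel, zero_add] at h3
      have h4 : ℓ (θ (i + n)) + variationOnFromTo γ univ (θ (i + n)) (2 * Real.pi) = L :=
        hadd 0 (θ (i + n)) (2 * Real.pi)
      change _ + ℓ (θ i) = _ at h2
      exact ENNReal.ofReal_le_ofReal (by linarith)
  -- Equality of arc length already forces equality of the points, so `θ 0 = 0` and `θ (2 * n) = 2π`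
  -- are not needed.
  have hends : γ (θ (2 * n)) = γ (θ 0) := by
    have h1 : ∀ s t : ℝ, s ≤ t → ℓ s = ℓ t → γ s = γ t := by
      intro s t hst he
      have h1 := dist_le_variationOnFromTo hC hst
      have h2 : ℓ s + _ = ℓ t := hadd 0 s t
      exact dist_le_zero.1 (by linarith)
    have h2 := h1 0 (θ 0) (hθ 0 (by omega)).1 (by rw [hℓ0, hℓθ 0 (by omega)]; simp)
    have h3 := h1 (θ (2 * n)) (2 * Real.pi) (hθ _ le_rfl).2 (by
      rw [hℓθ _ le_rfl]
      push_cast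
      field_simp
      exact hL)
    rw [h3, ← h2]
    have := hper 0
    rwa [zero_add] at this
  obtain ⟨j, hj, hjmin⟩ := Finset.exists_min_image (Finset.range (n + 1))
    (fun i => ‖γ (θ (i + n)) - γ (θ i)‖) ⟨0, by simp⟩
  rw [Finset.mem_range] at hj
  refine ⟨γ (θ j), hfr _, γ (θ (j + n)), hfr _, L, hLpos, ?_, hpath j (by omega), hSL⟩
  rw [norm_sub_rev]
  set m := ‖γ (θ (j + n)) - γ (θ j)‖ with hm
  rcases (norm_nonneg (γ (θ (j + n)) - γ (θ j))).eq_or_lt with h | h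
  · rw [hm, ← h, mul_zero]
    exact hLpos.le
  · obtain ⟨i, hi, hstepi⟩ := exists_step_of_antipodal hn
      (fun i => γ (θ (i + n)) - γ (θ i)) (by
        simp only [zero_add, neg_sub]
        rw [← two_mul, hends]) h
      (fun i hi => hjmin i (Finset.mem_range.2 (by omega)))
    have e : γ (θ (i + 1 + n)) - γ (θ (i + 1)) - (γ (θ (i + n)) - γ (θ i))
        = (γ (θ (i + n + 1)) - γ (θ (i + n))) - (γ (θ (i + 1)) - γ (θ i)) := by
      rw [add_right_comm i 1 n]
      abel
    rw [e] at hstepi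
    have h1 := hstep i (i + 1) (by omega) (by omega)
    have h2 := hstep (i + n) (i + n + 1) (by omega) (by omega)
    push_cast at h1 h2
    have h3 := hstepi.trans (norm_sub_le _ _)
    have h4 : 2 * m * Real.sin (Real.pi / (2 * n)) ≤ 2 * (L / (2 * n)) := by
      refine h3.trans ?_
      linarith
    have h5 : 2 * (L / (2 * n)) * n = L := by field_simp
    calc 2 * n * Real.sin (Real.pi / (2 * n)) * m
        = 2 * m * Real.sin (Real.pi / (2 * n)) * n := by ring
      _ ≤ 2 * (L / (2 * n)) * n := by gcongr
      _ = L := h5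

/-- The boundary of a planar convex body has distortion at least `π / 2`: up to the error in
`2 n sin (π / 2n) ≤ π`, some two points at intrinsic distance `L / 2` have distance at most
`L / π`, where `L` is at least the diameter up to a factor `2`. -/
theorem exists_halving_pair (hc : Convex ℝ S) (hb : Bornology.IsBounded S)
    (hint : (interior S).Nonempty) {n : ℕ} (hn : 0 < n) :
    ∃ x ∈ frontier S, ∃ y ∈ frontier S, ∃ L : ℝ, 0 < L ∧
      2 * n * Real.sin (Real.pi / (2 * n)) * ‖x - y‖ ≤ L ∧
      (∀ σ : Path x y, (∀ t, σ t ∈ frontier S) → ENNReal.ofReal (L / 2) ≤ eVariationOn σ univ) ∧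
      ∀ s ∈ S, ∀ s' ∈ S, ‖s - s'‖ ≤ 2 * L := by
  obtain ⟨c, hc0⟩ := hint
  let e : ℂ ≃ₜ ℂ := Homeomorph.addRight (-c)
  have hfr : ∀ z, z - c ∈ frontier (e '' S) ↔ z ∈ frontier S := by
    intro z
    rw [← e.image_frontier]
    constructor
    · rintro ⟨w, hw, hwz⟩
      have : w = z := by
        have : w + -c = z - c := hwz
        rw [← sub_eq_add_neg] at this
        exact sub_left_injective this
      rwa [← this]
    · intro hz
      exact ⟨z, hz, (sub_eq_add_neg z c).symm⟩
  have hconv : Convex ℝ (e '' S) := by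
    have : e '' S = (fun z => z + -c) '' S := rfl
    rw [this]
    simpa [add_comm] using hc.translate (-c)
  have hbd : Bornology.IsBounded (e '' S) := by
    have hl : LipschitzWith 1 e := LipschitzWith.of_dist_le_mul fun s t => by
      simp [e]
    exact hl.isBounded_image hb
  have hnh : e '' S ∈ nhds 0 := by
    rw [← mem_interior_iff_mem_nhds, ← e.image_interior]
    exact ⟨c, hc0, by simp [e]⟩
  obtain ⟨x, hx, y, hy, L, hL, hxy, hσ, hS⟩ := exists_halving_pair_of_mem_nhds hconv hbd hnh hn
  refine ⟨x + c, ?_, y + c, ?_, L, hL, ?_, ?_, ?_⟩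
  · rw [← hfr, add_sub_cancel_right]
    exact hx
  · rw [← hfr, add_sub_cancel_right]
    exact hy
  · rwa [add_sub_add_right_eq_sub]
  · intro σ hσf
    have hl : LipschitzOnWith 1 (fun z : ℂ => z - c) (frontier S) :=
      (LipschitzWith.of_dist_le_mul fun s t => by simp).lipschitzOnWith
    obtain ⟨σ', h1, h2⟩ := exists_path_comp_le σ hσf hl
    have := hσ (σ'.cast (by simp) (by simp)) fun t => by
      rw [Path.cast_coe, h1, hfr]
      exact hσf t
    refine this.trans ?_
    simpa using h2
  · intro s hs s' hs'
    have h1 := hS _ ⟨s, hs, rfl⟩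
    have h2 := hS _ ⟨s', hs', rfl⟩
    have h3 := norm_sub_le (e s) (e s')
    have h4 : e s - e s' = s - s' := by simp [e]
    rw [h4] at h3
    linarith

end HalfPerimeter

/-! ### Coordinates adapted to an axis -/

section Coordinates

/-- `j` identifies `ℂ` with the plane orthogonal to `e`, and `P` is its adjoint, the orthogonal
projection to that plane. Using `ℂ` makes the planar results and polar coordinates available for
slices. -/
theorem exists_axis_coordinates {e : E3} (he : ‖e‖ = 1) :
    ∃ (j : ℂ →ₗᵢ[ℝ] E3) (P : E3 →L[ℝ] ℂ), (∀ z, inner ℝ e (j z) = 0) ∧ (∀ z, P (j z) = z) ∧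
      P e = 0 ∧ (∀ z v, inner ℝ (j z) v = inner ℝ z (P v)) ∧
      ∀ v, v = inner ℝ e v • e + j (P v) := by
  have he0 : e ≠ 0 := by
    rintro rfl
    simp at he
  have : Fact (Module.finrank ℝ E3 = 2 + 1) := ⟨by simp⟩
  have hfin : Module.finrank ℝ (Submodule.span ℝ {e})ᗮ = 2 :=
    Submodule.finrank_orthogonal_span_singleton he0
  let b : OrthonormalBasis (Fin 2) ℝ (Submodule.span ℝ {e})ᗮ :=
    (stdOrthonormalBasis ℝ (Submodule.span ℝ {e})ᗮ).reindex (finCongr hfin)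
  let i : ℂ ≃ₗᵢ[ℝ] (Submodule.span ℝ {e})ᗮ :=
    Complex.orthonormalBasisOneI.equiv b (Equiv.refl _)
  let j : ℂ →ₗᵢ[ℝ] E3 := (Submodule.span ℝ {e})ᗮ.subtypeₗᵢ.comp i.toLinearIsometry
  let P : E3 →L[ℝ] ℂ := ContinuousLinearMap.adjoint j.toContinuousLinearMap
  have hj : ∀ z, inner ℝ e (j z) = 0 := fun z =>
    Submodule.mem_orthogonal_singleton_iff_inner_right.1 (i z).2
  have hadj : ∀ z v, inner ℝ (j z) v = inner ℝ z (P v) := fun z v =>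
    (ContinuousLinearMap.adjoint_inner_right j.toContinuousLinearMap z v).symm
  have hPj : ∀ z, P (j z) = z := by
    intro z
    refine ext_inner_left ℝ fun w => ?_
    rw [← hadj, j.inner_map_map]
  refine ⟨j, P, hj, hPj, ?_, hadj, fun v => ?_⟩
  · refine ext_inner_left ℝ fun w => ?_
    rw [← hadj, real_inner_comm, hj, inner_zero_right]
  · have hmem : v - inner ℝ e v • e ∈ (Submodule.span ℝ {e})ᗮ := by
      rw [Submodule.mem_orthogonal_singleton_iff_inner_right, inner_sub_right, inner_smul_right,
        real_inner_self_eq_norm_sq, he]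
      ring
    obtain ⟨z, hz⟩ := i.surjective ⟨_, hmem⟩
    have hz' : j z = v - inner ℝ e v • e := congrArg Subtype.val hz
    have hPe : P e = 0 := by
      refine ext_inner_left ℝ fun w => ?_
      rw [← hadj, real_inner_comm, hj, inner_zero_right]
    have hPv : P v = z := by
      rw [← hPj z, hz', map_sub, map_smul, hPe, smul_zero, sub_zero]
    rw [hPv, hz']
    abel

/-- In the complex coordinate on the plane orthogonal to `e`, the third vector is `f` multiplied by
`i`. -/
theorem exists_orthonormal_completion {e f : E3} (he : ‖e‖ = 1) (hf : ‖f‖ = 1)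
    (hef : inner ℝ e f = 0) : ∃ n : E3, ‖n‖ = 1 ∧
      ∀ v, v = inner ℝ e v • e + inner ℝ f v • f + inner ℝ n v • n := by
  obtain ⟨j, P, hj, hPj, hPe, hadj, hdec⟩ := exists_axis_coordinates he
  have hfj : j (P f) = f := by
    have := hdec f
    rw [hef, zero_smul, zero_add] at this
    exact this.symm
  set u := P f with hu
  have hu1 : ‖u‖ = 1 := by rw [← j.norm_map, hfj, hf]
  have hsq : u.re * u.re + u.im * u.im = 1 := by
    rw [← Complex.normSq_apply, Complex.normSq_eq_norm_sq, hu1, one_pow]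
  refine ⟨j (Complex.I * u), by rw [j.norm_map, norm_mul, Complex.norm_I, hu1, one_mul],
    fun v => ?_⟩
  conv_lhs => rw [hdec v]
  rw [add_assoc]
  congr 1
  have h1 : inner ℝ f v = inner ℝ u (P v) := by rw [← hadj, hfj]
  have h2 : inner ℝ u (P v) • f = j (inner ℝ u (P v) • u) := by rw [map_smul, hfj]
  rw [h1, hadj, h2, ← j.map_smul, ← j.map_add]
  congr 1
  apply Complex.ext
  · simp [Complex.inner]
    linear_combination (-(P v).re) * hsq
  · simp [Complex.inner]
    linear_combination (-(P v).im) * hsq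

end Coordinates

/-! ### Fat discs force fat bodies -/

section LowerBounds

variable {A K : Set E3} {κ : ℝ}

/-- For `p = q` the distortion gives no information, but the constant path has length zero and
forces `c ≤ 0`. Covering this case spares the applications a proof that the points differ. -/
theorem le_mul_norm_of_distortion_le (hκ : 0 ≤ κ) (h : distortion A ≤ ENNReal.ofReal κ)
    {p q : E3} (hp : p ∈ A) (hq : q ∈ A) {c : ℝ}
    (hlow : ∀ σ : Path p q, (∀ t, σ t ∈ A) → ENNReal.ofReal c ≤ eVariationOn σ univ) :
    c ≤ κ * ‖p - q‖ := by
  by_cases hpq : p = q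
  · subst hpq
    have h1 := hlow (Path.refl p) fun t => by simpa using hp
    rw [eVariationOn.constant_on (by
      rintro _ ⟨s, -, rfl⟩ _ ⟨t, -, rfl⟩
      simp), nonpos_iff_eq_zero, ENNReal.ofReal_eq_zero] at h1
    simpa using h1
  · have h1 := intrinsicEDist_le_of_distortion_le h hp hq hpq
    have h2 : ENNReal.ofReal c ≤ intrinsicEDist A p q := le_iInf₂ hlow
    have h3 := h2.trans h1
    rwa [edist_dist, ← ENNReal.ofReal_mul hκ, dist_eq_norm,
      ENNReal.ofReal_le_ofReal_iff (by positivity)] at h3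

theorem add_smul_mem_of_endpoints_mem (hconv : Convex ℝ K) {m e : E3} {r s : ℝ} (hr : 0 < r)
    (h1 : m - r • e ∈ K) (h2 : m + r • e ∈ K) (hs : |s| ≤ r) : m + s • e ∈ K := by
  have h := abs_le.1 hs
  have := hconv h1 h2 (a := (r - s) / (2 * r)) (b := (r + s) / (2 * r))
    (div_nonneg (by linarith) (by linarith)) (div_nonneg (by linarith) (by linarith))
    (by field_simp; ring)
  convert this using 1
  have e1 : (r - s) / (2 * r) + (r + s) / (2 * r) = 1 := by field_simp; ring
  have e2 : ((r + s) / (2 * r) - (r - s) / (2 * r)) * r = s := by field_simp; ring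
  rw [smul_sub, smul_add, smul_smul, smul_smul]
  calc m + s • e = ((r - s) / (2 * r) + (r + s) / (2 * r)) • m
        + (((r + s) / (2 * r) - (r - s) / (2 * r)) * r) • e := by rw [e1, e2, one_smul]
    _ = _ := by
        rw [add_smul, sub_mul, sub_smul]
        abel

/-- A body of small distortion that contains a planar disc in its interior contains a ball of
comparable radius. -/
theorem exists_ball_subset_of_disc_subset (hconv : Convex ℝ K) (hcomp : IsCompact K)
    (hκ : 0 < κ) (h : distortion (frontier K) ≤ ENNReal.ofReal κ) {x n : E3} {ρ : ℝ}
    (hρ : 0 < ρ) (hn : ‖n‖ = 1)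
    (hdisc : ∀ v, inner ℝ n v = 0 → ‖v‖ ≤ ρ → x + v ∈ interior K) :
    ∃ c, ball c (min (1 / κ) 1 * ρ / 4) ⊆ K := by
  have hxint : x ∈ interior K := by
    simpa using hdisc 0 (inner_zero_right _) (by simpa using hρ.le)
  have hxK := interior_subset hxint
  have hray : ∀ ν : E3, ‖ν‖ = 1 → ∃ s : ℝ, 0 ≤ s ∧ x + s • ν ∈ frontier K := by
    intro ν hν
    have hpre : IsPreconnected ((fun s : ℝ => x + s • ν) '' Ici 0) :=
      isPreconnected_Ici.image _ (by fun_prop)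
    obtain ⟨R, hR⟩ := hcomp.isBounded.subset_closedBall x
    obtain ⟨_, ⟨s, hs, rfl⟩, hp⟩ := exists_mem_frontier_of_isPreconnected (s := K) hpre
      ⟨x, ⟨0, by simp, by simp⟩, hxK⟩
      ⟨x + (|R| + 1) • ν, ⟨_, mem_Ici.2 (by positivity), rfl⟩, fun hm => by
        have := hR hm
        rw [mem_closedBall, dist_eq_norm, add_sub_cancel_left, norm_smul, hν, mul_one,
          Real.norm_eq_abs, abs_of_nonneg (by positivity)] at this
        linarith [le_abs_self R]⟩
    exact ⟨s, hs, hp⟩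
  obtain ⟨s, hs, hp⟩ := hray n hn
  obtain ⟨s', hs', hq⟩ := hray (-n) (by rwa [norm_neg])
  have hnn : inner ℝ n n = (1 : ℝ) := by rw [real_inner_self_eq_norm_sq, hn, one_pow]
  have hfar : ∀ z ∈ frontier K, inner ℝ n (z - x) = 0 → ∀ t : ℝ, ρ ≤ ‖z - (x + t • n)‖ := by
    intro z hz hz0 t
    have h1 : ρ ≤ ‖z - x‖ := by
      by_contra! hlt
      have := hdisc (z - x) hz0 hlt.le
      rw [add_sub_cancel] at this
      exact hz.2 this
    refine h1.trans (le_of_sq_le_sq ?_ (norm_nonneg _))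
    have e : z - (x + t • n) = (z - x) - t • n := by abel
    rw [e, norm_sub_sq_real (z - x) (t • n), inner_smul_right, real_inner_comm, hz0]
    nlinarith [sq_nonneg ‖t • n‖]
  -- A boundary path between the two sides meets the plane of the disc at a boundary point, hence
  -- outside the disc, at distance at least `ρ` from both endpoints.
  have hlen : 2 * ρ ≤ κ * ‖(x + s • n) - (x + s' • -n)‖ := by
    refine le_mul_norm_of_distortion_le hκ.le h hp hq fun σ hσ => ?_
    have hcont : Continuous fun t => inner ℝ n (σ t - x) :=
      continuous_const.inner (σ.continuous.sub continuous_const)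
    obtain ⟨t, ht⟩ : (0 : ℝ) ∈ range fun t => inner ℝ n (σ t - x) := by
      refine mem_range_of_exists_le_of_exists_ge hcont ⟨1, ?_⟩ ⟨0, ?_⟩
      · rw [σ.target, add_sub_cancel_left, smul_neg, inner_neg_right, inner_smul_right, hnn]
        linarith
      · rw [σ.source, add_sub_cancel_left, inner_smul_right, hnn]
        linarith
    refine le_trans ?_ (edist_add_edist_le_eVariationOn_path σ t)
    rw [edist_dist, edist_dist, ← ENNReal.ofReal_add dist_nonneg dist_nonneg]
    refine ENNReal.ofReal_le_ofReal ?_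
    have h1 := hfar _ (hσ t) ht s
    have h2 := hfar _ (hσ t) ht (-s')
    rw [dist_comm, dist_eq_norm, dist_eq_norm]
    rw [neg_smul, ← smul_neg] at h2
    linarith
  have e : (x + s • n) - (x + s' • -n) = (s + s') • n := by
    rw [add_smul, smul_neg]
    abel
  rw [e, norm_smul, hn, mul_one, Real.norm_eq_abs, abs_of_nonneg (by linarith)] at hlen
  obtain ⟨ν, hν, hνn, s₀, hs₀, hs₀K⟩ : ∃ ν : E3, ‖ν‖ = 1 ∧
      (∀ v, inner ℝ ν v = 0 → inner ℝ n v = 0) ∧ ∃ s₀ : ℝ, ρ / κ ≤ s₀ ∧ x + s₀ • ν ∈ K := by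
    have hcl := hcomp.isClosed.frontier_subset
    rcases le_total (ρ / κ) s with h1 | h1
    · exact ⟨n, hn, fun _ => id, s, h1, hcl hp⟩
    · refine ⟨-n, by rwa [norm_neg], fun v hv => by simpa using hv, s', ?_, hcl hq⟩
      rw [div_le_iff₀ hκ]
      rw [le_div_iff₀ hκ] at h1
      nlinarith
  -- The cone over the disc with apex at height `s₁` lies in `K`. Since `s₁ ≤ ρ`, it contains the
  -- ball of radius `s₁ / 4` around the point at height `s₁ / 2`.
  set s₁ := min (1 / κ) 1 * ρ with hs₁
  have hs₁pos : 0 < s₁ := by positivity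
  have hs₁ρ : s₁ ≤ ρ := by
    rw [hs₁]
    nlinarith [min_le_right (1 / κ) 1]
  have hs₁s : s₁ ≤ s₀ := by
    refine le_trans ?_ hs₀
    rw [hs₁, div_eq_mul_one_div ρ, mul_comm ρ]
    exact mul_le_mul_of_nonneg_right (min_le_left _ _) hρ.le
  have hs₁K : x + s₁ • ν ∈ K := by
    have := hconv hxK hs₀K (a := 1 - s₁ / s₀) (b := s₁ / s₀)
      (by rw [sub_nonneg, div_le_one (by linarith)]; exact hs₁s)
      (div_nonneg hs₁pos.le (by linarith)) (by ring)
    convert this using 1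
    rw [smul_add, smul_smul, div_mul_cancel₀ _ (by linarith : (0 : ℝ) < s₀).ne', ← add_assoc,
      ← add_smul, sub_add_cancel, one_smul]
  refine ⟨x + (s₁ / 2) • ν, fun u hu => ?_⟩
  rw [mem_ball, dist_eq_norm] at hu
  have hνν : inner ℝ ν ν = (1 : ℝ) := by rw [real_inner_self_eq_norm_sq, hν, one_pow]
  set h₁ := inner ℝ ν (u - x) with hh₁
  set v := u - x - h₁ • ν with hv
  have hv0 : inner ℝ ν v = 0 := by
    rw [hv, inner_sub_right, inner_smul_right, hνν, ← hh₁]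
    ring
  have edec : u - (x + (s₁ / 2) • ν) = v + (h₁ - s₁ / 2) • ν := by
    rw [hv, sub_smul]
    abel
  have hsq : ‖u - (x + (s₁ / 2) • ν)‖ ^ 2 = ‖v‖ ^ 2 + (h₁ - s₁ / 2) ^ 2 := by
    rw [edec, norm_add_sq_real, inner_smul_right, real_inner_comm, hv0, norm_smul, hν,
      Real.norm_eq_abs, mul_one, sq_abs]
    ring
  have hvlt : ‖v‖ ≤ s₁ / 4 := by
    refine (le_of_sq_le_sq ?_ (norm_nonneg _)).trans hu.le
    rw [hsq]
    nlinarith [sq_nonneg (h₁ - s₁ / 2)]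
  have hhlt : |h₁ - s₁ / 2| ≤ s₁ / 4 := by
    refine (le_of_sq_le_sq ?_ (norm_nonneg _)).trans hu.le
    rw [hsq, sq_abs]
    nlinarith [sq_nonneg ‖v‖]
  rw [abs_le] at hhlt
  -- `θ` is the weight of the apex when `u` is written as a convex combination of the apex and a
  -- point of the disc.
  set θ := h₁ / s₁ with hθ
  have hθ1 : 1 / 4 ≤ θ := by
    rw [hθ, le_div_iff₀ hs₁pos]
    linarith [hhlt.1]
  have hθ2 : θ ≤ 3 / 4 := by
    rw [hθ, div_le_iff₀ hs₁pos]
    linarith [hhlt.2]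
  have hy : x + (1 - θ)⁻¹ • v ∈ K := by
    refine interior_subset (hdisc _ (hνn _ (by rw [inner_smul_right, hv0, mul_zero])) ?_)
    rw [norm_smul, norm_inv, Real.norm_eq_abs, abs_of_pos (by linarith)]
    rw [inv_mul_le_iff₀ (by linarith)]
    nlinarith
  have := hconv hy hs₁K (a := 1 - θ) (b := θ) (by linarith) (by linarith) (by ring)
  convert this using 1
  rw [smul_add, smul_add, smul_smul, smul_smul, mul_inv_cancel₀ (by linarith), one_smul, hθ,
    div_mul_cancel₀ _ hs₁pos.ne', sub_smul, one_smul, hv]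
  abel

end LowerBounds

open Filter Topology
open scoped Pointwise

/-! ### Distortion below `π / 2` bounds the eccentricity -/

section Eccentricity

theorem frontier_smul_of_ne_zero {E : Type*} [NormedAddCommGroup E] [NormedSpace ℝ E] {c : ℝ}
    (hc : c ≠ 0) (S : Set E) : frontier (c • S) = c • frontier S :=
  ((Homeomorph.smulOfNeZero c hc).image_frontier S).symm

theorem tendsto_mul_sin_pi_div :
    Tendsto (fun n : ℕ => 2 * (n : ℝ) * Real.sin (Real.pi / (2 * n))) atTop (𝓝 Real.pi) := by
  have h := (Real.continuous_sinc.tendsto 0).comp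
    ((tendsto_const_div_atTop_nhds_zero_nat (Real.pi / 2)))
  rw [Real.sinc_zero] at h
  have h2 := h.const_mul Real.pi
  rw [mul_one] at h2
  refine h2.congr' ?_
  filter_upwards [eventually_gt_atTop 0] with n hn
  have hn' : (0 : ℝ) < n := by exact_mod_cast hn
  have hpi := Real.pi_pos
  have hne : Real.pi / 2 / n ≠ 0 := by positivity
  rw [Function.comp_apply, Real.sinc_of_ne_zero hne, div_div]
  field_simp

variable {K : Set E3} {κ : ℝ}

/-- If a convex body is long and thin, its distortion is close to that of a planar curve, hence
almost `π / 2`. -/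
theorem exists_far_point_of_distortion_le (hκ : 0 < κ) (hκπ : κ < Real.pi / 2) :
    ∃ c : ℝ, 0 < c ∧ ∀ K : Set E3, Convex ℝ K → IsCompact K → (interior K).Nonempty →
      distortion (frontier K) ≤ ENNReal.ofReal κ → ∀ (m e : E3) (r : ℝ), ‖e‖ = 1 → 0 < r →
      m - r • e ∈ K → m + r • e ∈ K → ∃ w, inner ℝ e w = 0 ∧ m + w ∈ K ∧ c * r ≤ ‖w‖ := by
  -- `n` is so large that the polygonal constant `A`, which tends to `π`, exceeds `2κ`; then `δ > 0`
  -- is the gain over the planar curve.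
  obtain ⟨n, hn0, hn⟩ : ∃ n : ℕ, 0 < n ∧ 2 * κ < 2 * n * Real.sin (Real.pi / (2 * n)) :=
    ((eventually_gt_atTop 0).and
      (tendsto_mul_sin_pi_div.eventually (lt_mem_nhds (by linarith : 2 * κ < Real.pi)))).exists
  set A := 2 * (n : ℝ) * Real.sin (Real.pi / (2 * n)) with hA
  have hApos : 0 < A := by linarith
  set δ := 1 / 2 - κ / A with hδ
  have hδpos : 0 < δ := by
    rw [hδ, sub_pos, div_lt_iff₀ hApos]
    linarith
  -- The shrinking factor is `1 - lam`; this value makes the loss `lam (4κ + δ)` equal to half the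
  -- gain `δ`.
  set lam := δ / (2 * (4 * κ + δ)) with hlam
  have hlampos : 0 < lam := by positivity
  have hlamδ : lam * (4 * κ + δ) = δ / 2 := by
    rw [hlam]
    field_simp
  have hlam1 : lam < 1 := by
    rw [hlam, div_lt_one (by positivity)]
    linarith
  have hμ : 0 < 1 - lam := by linarith
  refine ⟨lam / (2 * κ), by positivity, ?_⟩
  intro K hconv hcomp hint hdist m e r he hr ha hb
  obtain ⟨j, P, hj, hPj, hPe, hadj, hdec⟩ := exists_axis_coordinates he
  set S : Set ℂ := {z | m + j z ∈ K} with hS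
  have haxis : ∀ s : ℝ, |s| ≤ r → m + s • e ∈ K := fun s hs =>
    add_smul_mem_of_endpoints_mem hconv hr ha hb hs
  have hjc : Continuous fun z => m + j z := continuous_const.add j.continuous
  have hS0 : (0 : ℂ) ∈ S := by
    have := haxis 0 (by simpa using hr.le)
    simpa [hS] using this
  have hSc : Convex ℝ S := by
    intro z hz w hw a b ha hb hab
    have := hconv hz hw ha hb hab
    simp only [hS, mem_ofPred_eq]
    convert this using 1
    rw [map_add, map_smul, map_smul, smul_add, smul_add]
    calc m + (a • j z + b • j w) = (a + b) • m + (a • j z + b • j w) := by rw [hab, one_smul]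
      _ = _ := by rw [add_smul]; abel
  have hScl : IsClosed S := hcomp.isClosed.preimage hjc
  have hSb : Bornology.IsBounded S := by
    obtain ⟨R, hR⟩ := hcomp.isBounded.subset_closedBall m
    refine (isBounded_closedBall (x := (0 : ℂ)) (r := R)).subset fun z hz => ?_
    have := hR hz
    rw [mem_closedBall, dist_eq_norm, add_sub_cancel_left, j.norm_map] at this
    simpa using this
  have hSint : ∀ z, m + j z ∈ interior K → z ∈ interior S := by
    intro z hz
    exact interior_maximal (t := (fun z => m + j z) ⁻¹' interior K)
      (fun w hw => interior_subset (s := K) hw) (isOpen_interior.preimage hjc) hz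
  -- The ends of the axis segment are limits of interior points on both sides of the slicing plane,
  -- and the interior is connected, so it meets the plane.
  have hSne : (interior S).Nonempty := by
    have hcl : closure (interior K) = K := by
      rw [hconv.closure_interior_eq_closure_of_nonempty_interior hint, hcomp.isClosed.closure_eq]
    have hf : Continuous fun v : E3 => inner ℝ e (v - m) := by fun_prop
    rw [← hcl] at ha hb
    obtain ⟨a', ha'1, ha'2⟩ := mem_closure_iff.1 ha {v | inner ℝ e (v - m) < (0 : ℝ)}
      (isOpen_lt hf continuous_const) (by
        simp [inner_smul_right, he, hr])
    obtain ⟨b', hb'1, hb'2⟩ := mem_closure_iff.1 hb {v | (0 : ℝ) < inner ℝ e (v - m)}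
      (isOpen_lt continuous_const hf) (by
        simp [inner_smul_right, he, hr])
    obtain ⟨w, hw, hw0⟩ := hconv.interior.isPreconnected.intermediate_value ha'2 hb'2
      hf.continuousOn ⟨le_of_lt ha'1, le_of_lt hb'1⟩
    refine ⟨P (w - m), hSint _ ?_⟩
    have := hdec (w - m)
    simp only at hw0
    rw [hw0, zero_smul, zero_add] at this
    rwa [← this, add_sub_cancel]
  set C : Set ℂ := (1 - lam) • S with hC
  have hCS : C ⊆ S := by
    rintro _ ⟨z, hz, rfl⟩
    have := hSc hz hS0 hμ.le hlampos.le (by ring)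
    simpa using this
  have hCc : Convex ℝ C := hSc.smul _
  have hCcl : IsClosed C := hScl.smul₀ _
  have hCint : (interior C).Nonempty := by
    rw [hC, interior_smul₀ hμ.ne']
    exact hSne.smul_set
  -- The slab contains the cylinder over the shrunken slice `C`: mix a slice point with weight `1 -
  -- lam` and an axis point with weight `lam`.
  have hCK : ∀ v, |inner ℝ e (v - m)| ≤ lam * r → P (v - m) ∈ C → v ∈ K := by
    rintro v hv ⟨z, hz, hzv⟩
    set s := inner ℝ e (v - m) with hs
    have h1 : m + (s / lam) • e ∈ K := by
      refine haxis _ ?_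
      rw [abs_div, abs_of_pos hlampos, div_le_iff₀ hlampos]
      linarith
    have h2 := hconv hz h1 hμ.le hlampos.le (by ring)
    convert h2 using 1
    have h3 := hdec (v - m)
    have h4 : (1 - lam) • z = P (v - m) := hzv
    rw [← h4, map_smul, ← hs] at h3
    rw [smul_add, smul_add, smul_smul, mul_div_cancel₀ _ hlampos.ne', sub_smul 1 lam m, one_smul,
      ← sub_add_cancel v m, h3]
    abel
  have hCint' : ∀ v ∈ frontier K, |inner ℝ e (v - m)| < lam * r → P (v - m) ∉ interior C := by
    intro v hv hlt hmem
    refine hv.2 (interior_maximal (t := {v | |inner ℝ e (v - m)| < lam * r} ∩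
      {v | P (v - m) ∈ interior C}) ?_ ?_ ⟨hlt, hmem⟩)
    · rintro u ⟨h1, h2⟩
      exact hCK u (le_of_lt h1) (interior_subset h2)
    · refine IsOpen.inter (isOpen_lt (by fun_prop) continuous_const)
        (isOpen_interior.preimage (by fun_prop))
  obtain ⟨π, hπ⟩ := exists_isMetricProj (hCint.mono interior_subset) hCcl.isComplete hCc
  obtain ⟨x, hx, y, hy, L, hL, hxy, hσ, hdiam⟩ := exists_halving_pair hSc hSb hSne hn0
  -- The halving pair is used for the shrunken curve: `p` and `q` are boundary points of the full
  -- slice that project onto its two scaled points.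
  have hlift : ∀ x ∈ frontier S, ∃ p ∈ frontier S, π p = (1 - lam) • x := by
    intro x hx
    refine hπ.exists_mem_frontier_of_subset hCc hCcl hCint hCS hSb ?_
    rw [hC, frontier_smul_of_ne_zero hμ.ne']
    exact smul_mem_smul_set hx
  obtain ⟨p, hp, hπp⟩ := hlift x hx
  obtain ⟨q, hq, hπq⟩ := hlift y hy
  have hfrS := hScl.frontier_subset
  have hfr : ∀ z ∈ frontier S, m + j z ∈ frontier K := by
    intro z hz
    exact ⟨subset_closure (hfrS hz), fun h => hz.2 (hSint z h)⟩
  have hnear : ∀ z ∈ frontier S, ‖z - π z‖ ≤ lam * (2 * L) := by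
    intro z hz
    refine (hπ.norm_sub_le z (smul_mem_smul_set (a := 1 - lam) (hfrS hz))).trans ?_
    have e1 : z - (1 - lam) • z = lam • z := by rw [sub_smul, one_smul, sub_sub_cancel]
    rw [e1, norm_smul, Real.norm_eq_abs, abs_of_pos hlampos]
    have := hdiam z (hfrS hz) 0 hS0
    rw [sub_zero] at this
    gcongr
  have hpq : ‖p - q‖ ≤ (1 - lam) * (L / A) + 4 * lam * L := by
    have e1 : p - q = (p - π p) + (1 - lam) • (x - y) - (q - π q) := by
      rw [hπp, hπq, smul_sub]
      abel
    have h1 := hnear p hp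
    have h2 := hnear q hq
    have h3 : ‖(1 - lam) • (x - y)‖ ≤ (1 - lam) * (L / A) := by
      rw [norm_smul, Real.norm_eq_abs, abs_of_pos hμ]
      gcongr
      rw [le_div_iff₀ hApos]
      linarith
    have h4 := norm_sub_le ((p - π p) + (1 - lam) • (x - y)) (q - π q)
    have h5 := norm_add_le (p - π p) ((1 - lam) • (x - y))
    rw [← e1] at h4
    linarith
  -- A path that leaves the slab has length at least `lam * r`. One that stays inside avoids the
  -- interior of the cylinder over `C`, so projecting it gives a path in the boundary of `C`, of
  -- length at least half the perimeter.
  have hlow : min (lam * r) ((1 - lam) * (L / 2)) ≤ κ * ‖(m + j p) - (m + j q)‖ := by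
    refine le_mul_norm_of_distortion_le hκ.le hdist (hfr p hp) (hfr q hq) fun σ hσK => ?_
    by_cases hex : ∃ t, lam * r ≤ |inner ℝ e (σ t - m)|
    · obtain ⟨t, ht⟩ := hex
      refine (ENNReal.ofReal_le_ofReal (min_le_left _ _)).trans ?_
      refine le_trans ?_ (le_self_add.trans (edist_add_edist_le_eVariationOn_path σ t))
      rw [edist_dist, dist_comm, dist_eq_norm]
      refine ENNReal.ofReal_le_ofReal (ht.trans ?_)
      have h1 : inner ℝ e (σ t - m) = inner ℝ e (σ t - (m + j p)) := by
        rw [← sub_sub, inner_sub_right _ _ (j p), hj, sub_zero]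
      rw [h1]
      refine (abs_real_inner_le_norm _ _).trans ?_
      rw [he, one_mul]
    · push Not at hex
      refine (ENNReal.ofReal_le_ofReal (min_le_right _ _)).trans ?_
      have hl : LipschitzWith 1 fun v : E3 => π (P (v - m)) := by
        have hP : LipschitzWith 1 fun v : E3 => P (v - m) := by
          refine LipschitzWith.of_dist_le_mul fun u v => ?_
          rw [NNReal.coe_one, one_mul, dist_eq_norm, dist_eq_norm, ← map_sub,
            sub_sub_sub_cancel_right]
          refine le_of_sq_le_sq ?_ (norm_nonneg _)
          have h1 := hdec (u - v)
          have h2 : ‖u - v‖ ^ 2 = inner ℝ e (u - v) ^ 2 + ‖P (u - v)‖ ^ 2 := by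
            conv_lhs => rw [h1]
            rw [norm_add_sq_real, real_inner_smul_left, hj, norm_smul, he, j.norm_map, mul_one,
              Real.norm_eq_abs, sq_abs]
            ring
          rw [h2]
          nlinarith [sq_nonneg (inner ℝ e (u - v))]
        exact (hπ.lipschitz.comp hP).weaken (by simp)
      have hl2 : LipschitzWith (Real.toNNReal (1 - lam)⁻¹)
          fun v : E3 => (1 - lam)⁻¹ • π (P (v - m)) := by
        refine LipschitzWith.of_dist_le_mul fun u v => ?_
        rw [dist_smul₀, Real.norm_eq_abs, abs_of_pos (inv_pos.2 hμ),
          Real.coe_toNNReal _ (inv_pos.2 hμ).le]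
        have := hl.dist_le_mul u v
        rw [NNReal.coe_one, one_mul] at this
        have := inv_pos.2 hμ
        gcongr
      obtain ⟨σ', h1, h2⟩ := exists_path_comp_le σ hσK (hl2.lipschitzOnWith (s := frontier K))
      have hend : ∀ z w, π z = (1 - lam) • w → (1 - lam)⁻¹ • π (P (m + j z - m)) = w := by
        intro z w hzw
        rw [add_sub_cancel_left, hPj, hzw, smul_smul, inv_mul_cancel₀ hμ.ne', one_smul]
      have h3 := hσ (σ'.cast (hend p x hπp).symm (hend q y hπq).symm) fun t => by
        rw [Path.cast_coe, h1]
        have h4 := hπ.mem_frontier (hCint' _ (hσK t) (hex t))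
        rw [hC, frontier_smul_of_ne_zero hμ.ne'] at h4
        obtain ⟨z, hz, hzz⟩ := h4
        have hzz' : (1 - lam) • z = π (P (σ t - m)) := hzz
        rw [← hzz', smul_smul, inv_mul_cancel₀ hμ.ne', one_smul]
        exact hz
      rw [Path.cast_coe] at h3
      rw [ENNReal.ofReal_mul hμ.le]
      calc ENNReal.ofReal (1 - lam) * ENNReal.ofReal (L / 2)
          ≤ ENNReal.ofReal (1 - lam) * (ENNReal.ofReal (1 - lam)⁻¹ * eVariationOn σ univ) := by
            gcongr
            exact h3.trans h2
        _ = eVariationOn σ univ := by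
            rw [← mul_assoc, ← ENNReal.ofReal_mul hμ.le, mul_inv_cancel₀ hμ.ne',
              ENNReal.ofReal_one, one_mul]
  rw [add_sub_add_left_eq_sub, ← map_sub, j.norm_map] at hlow
  -- By the choice of `lam` the second alternative is impossible, so `p` and `q` are far apart and
  -- one of them is far from the axis.
  have hcontra : κ * ‖p - q‖ < (1 - lam) * (L / 2) := by
    have h1 : κ * ‖p - q‖ ≤ κ * ((1 - lam) * (L / A) + 4 * lam * L) := by gcongr
    refine h1.trans_lt ?_
    have h2 : κ * ((1 - lam) * (L / A) + 4 * lam * L)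
        = L * ((1 - lam) * (κ / A) + 4 * κ * lam) := by ring
    have h3 : κ / A = 1 / 2 - δ := by rw [hδ]; ring
    rw [h2, h3]
    have h4 : (1 - lam) * (1 / 2 - δ) + 4 * κ * lam < (1 - lam) / 2 := by nlinarith
    have := mul_lt_mul_of_pos_left h4 hL
    linarith
  have hmain : lam * r ≤ κ * ‖p - q‖ := by
    rcases min_le_iff.1 hlow with h | h
    · exact h
    · linarith
  have hex : ∃ z ∈ S, lam / (2 * κ) * r ≤ ‖z‖ := by
    by_contra! hlt
    have h1 := hlt p (hfrS hp)
    have h2 := hlt q (hfrS hq)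
    have h3 := norm_sub_le p q
    have h4 : κ * ‖p - q‖ < κ * (2 * (lam / (2 * κ) * r)) := by
      gcongr
      linarith
    have h5 : κ * (2 * (lam / (2 * κ) * r)) = lam * r := by field_simp
    linarith
  obtain ⟨z, hz, hzr⟩ := hex
  exact ⟨j z, hj z, hz, by rwa [j.norm_map]⟩

end Eccentricity

theorem exists_diameter {K : Set E3} (hcomp : IsCompact K) (hint : (interior K).Nonempty) :
    ∃ a ∈ K, ∃ b ∈ K, 0 < ‖b - a‖ ∧ ∀ x ∈ K, ∀ y ∈ K, ‖x - y‖ ≤ ‖b - a‖ := by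
  have hne := hint.mono interior_subset
  obtain ⟨⟨a, b⟩, ⟨ha, hb⟩, hmax⟩ := (hcomp.prod hcomp).exists_isMaxOn (hne.prod hne)
    (f := fun p : E3 × E3 => ‖p.2 - p.1‖)
    (continuous_snd.sub continuous_fst).norm.continuousOn
  have hdiam : ∀ x ∈ K, ∀ y ∈ K, ‖x - y‖ ≤ ‖b - a‖ := fun x hx y hy =>
    isMaxOn_iff.1 hmax (y, x) ⟨hy, hx⟩
  refine ⟨a, ha, b, hb, ?_, hdiam⟩
  by_contra! hle
  obtain ⟨y, hy⟩ := hint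
  have hsub : interior K ⊆ {y} := fun z hz =>
    mem_singleton_iff.2 (sub_eq_zero.1 (norm_le_zero_iff.1 ((hdiam z (interior_subset hz) y
      (interior_subset hy)).trans hle)))
  have h2 := interior_mono hsub
  rw [interior_interior, interior_singleton] at h2
  exact h2 hy

/-- A triangle with base of length `2 r` and height at least `k r` contains a disc of radius
`k r / 8`. -/
theorem exists_disc_subset_of_triangle {K : Set E3} (hconv : Convex ℝ K) {m e w : E3} {r k : ℝ}
    (he : ‖e‖ = 1) (hr : 0 < r) (ha : m - r • e ∈ K) (hb : m + r • e ∈ K)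
    (hew : inner ℝ e w = 0) (hw : m + w ∈ K) (hk : 0 < k) (hk1 : k ≤ 1) (hwr : k * r ≤ ‖w‖) :
    ∃ n : E3, ‖n‖ = 1 ∧
      ∀ v, inner ℝ n v = 0 → ‖v‖ ≤ k * r / 8 → m + (1 / 2 : ℝ) • w + v ∈ K := by
  have hw0 : 0 < ‖w‖ := lt_of_lt_of_le (by positivity) hwr
  obtain ⟨f, hf⟩ : ∃ f : E3, f = ‖w‖⁻¹ • w := ⟨_, rfl⟩
  have hf1 : ‖f‖ = 1 := by
    rw [hf, norm_smul, norm_inv, norm_norm, inv_mul_cancel₀ hw0.ne']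
  have hef : inner ℝ e f = 0 := by rw [hf, inner_smul_right, hew, mul_zero]
  obtain ⟨n, hn, hdec⟩ := exists_orthonormal_completion he hf1 hef
  refine ⟨n, hn, fun v hv hvρ => ?_⟩
  have hρr : k * r / 8 ≤ r / 8 := by nlinarith
  have hvdec := hdec v
  rw [hv, zero_smul, add_zero] at hvdec
  have hsle : |inner ℝ e v| ≤ k * r / 8 := by
    refine (abs_real_inner_le_norm _ _).trans ?_
    rwa [he, one_mul]
  have htle : |inner ℝ f v| ≤ k * r / 8 := by
    refine (abs_real_inner_le_norm _ _).trans ?_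
    rwa [hf1, one_mul]
  generalize (inner ℝ e v : ℝ) = s at *
  generalize (inner ℝ f v : ℝ) = t at *
  have htw : |t / ‖w‖| ≤ 1 / 8 := by
    rw [abs_div, abs_of_pos hw0, div_le_iff₀ hw0]
    linarith
  rw [abs_le] at htw
  -- `τ` is the weight of the apex `m + w`; it is at most `5 / 8`, so the remaining base point has
  -- offset `s / (1 - τ)` at most `r`.
  obtain ⟨τ, hτ⟩ : ∃ τ, τ = 1 / 2 + t / ‖w‖ := ⟨_, rfl⟩
  have hτ1 : 0 < 1 - τ := by linarith
  have h1 : m + (s / (1 - τ)) • e ∈ K := by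
    refine add_smul_mem_of_endpoints_mem hconv hr ha hb ?_
    rw [abs_div, abs_of_pos hτ1, div_le_iff₀ hτ1]
    nlinarith
  have h2 := hconv h1 hw hτ1.le (by linarith : 0 ≤ τ) (by ring)
  convert h2 using 1
  have h3 : τ • w = (1 / 2 : ℝ) • w + t • f := by
    rw [hτ, add_smul, hf, smul_smul t, div_eq_mul_inv t]
  rw [smul_add, smul_add, smul_smul, mul_div_cancel₀ _ hτ1.ne', h3, hvdec, sub_smul, one_smul]
  abel

/-- Convex bodies whose boundary has distortion at most `κ < π / 2` have uniformly bounded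
eccentricity. -/
theorem exists_ball_of_distortion_le {κ : ℝ} (hκ : 0 < κ) (hκπ : κ < Real.pi / 2) :
    ∃ C : ℝ, 0 < C ∧ ∀ K : Set E3, Convex ℝ K → IsCompact K → (interior K).Nonempty →
      distortion (frontier K) ≤ ENNReal.ofReal κ →
        ∃ (c : E3) (r : ℝ), 0 < r ∧ ball c r ⊆ K ∧ K ⊆ closedBall c (C * r) := by
  obtain ⟨c₁, hc₁, hfar⟩ := exists_far_point_of_distortion_le hκ hκπ
  obtain ⟨k₁, hk₁⟩ : ∃ k, k = min c₁ 1 := ⟨_, rfl⟩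
  have hk₁pos : 0 < k₁ := by rw [hk₁]; positivity
  obtain ⟨k₂, hk₂⟩ : ∃ k, k = min (1 / κ) 1 := ⟨_, rfl⟩
  have hk₂pos : 0 < k₂ := by rw [hk₂]; positivity
  -- The ball found below has radius `k₁ k₂ r / 64`, and the diameter of `K` is `2 r`.
  refine ⟨128 / (k₂ * k₁), by positivity, ?_⟩
  intro K hconv hcomp hint hdist
  obtain ⟨a, ha, b, hb, hD, hdiam⟩ := exists_diameter hcomp hint
  obtain ⟨m, e, r, hr, he1, hma, hmb⟩ : ∃ (m e : E3) (r : ℝ), r = ‖b - a‖ / 2 ∧ ‖e‖ = 1 ∧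
      m - r • e = a ∧ m + r • e = b := by
    have hre : (‖b - a‖ / 2) • ‖b - a‖⁻¹ • (b - a) = (1 / 2 : ℝ) • (b - a) := by
      rw [smul_smul]
      congr 1
      field_simp
    refine ⟨(1 / 2 : ℝ) • (a + b), ‖b - a‖⁻¹ • (b - a), _, rfl, ?_, ?_, ?_⟩
    · rw [norm_smul, norm_inv, norm_norm, inv_mul_cancel₀ hD.ne']
    · rw [hre]
      module
    · rw [hre]
      module
  have hrpos : 0 < r := by rw [hr]; positivity
  rw [← hma] at ha
  rw [← hmb] at hb
  obtain ⟨w, hew, hw, hwr⟩ := hfar K hconv hcomp hint hdist m e r he1 hrpos ha hb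
  have hwr' : k₁ * r ≤ ‖w‖ := by
    refine le_trans ?_ hwr
    gcongr
    rw [hk₁]
    exact min_le_left _ _
  obtain ⟨n, hn, hdisc⟩ := exists_disc_subset_of_triangle hconv he1 hrpos ha hb hew hw hk₁pos
    (hk₁ ▸ min_le_right _ _) hwr'
  obtain ⟨y, hy⟩ := hint
  -- Averaging the disc with an interior point `y` moves it into the interior at the cost of half
  -- its radius.
  obtain ⟨c, hc⟩ := exists_ball_subset_of_disc_subset (ρ := k₁ * r / 8 / 2)
    (x := (1 / 2 : ℝ) • (m + (1 / 2 : ℝ) • w) + (1 / 2 : ℝ) • y)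
    hconv hcomp hκ hdist (by positivity) hn (by
      intro v hv hvρ
      have h1 := hdisc ((2 : ℝ) • v) (by rw [inner_smul_right, hv, mul_zero]) (by
        rw [norm_smul, Real.norm_eq_abs, abs_of_pos two_pos]
        linarith)
      have h2 := hconv.combo_self_interior_mem_interior h1 hy
        (by norm_num : (0 : ℝ) ≤ 1 / 2) (by norm_num : (0 : ℝ) < 1 / 2) (by norm_num)
      convert h2 using 1
      module)
  rw [← hk₂] at hc
  have hRpos : 0 < k₂ * (k₁ * r / 8 / 2) / 4 := by positivity
  refine ⟨c, _, hRpos, hc, fun z hz => ?_⟩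
  rw [mem_closedBall, dist_eq_norm]
  have h1 := hdiam z hz c (hc (mem_ball_self hRpos))
  have h2 : 128 / (k₂ * k₁) * (k₂ * (k₁ * r / 8 / 2) / 4) = ‖b - a‖ := by
    rw [hr]
    field_simp
    norm_num
  rw [h2]
  exact h1

theorem mem_frontier_of_forall_add_smul_notMem {K : Set E3} {v d : E3} (hv : v ∈ K)
    (h : ∀ ε : ℝ, 0 < ε → v + ε • d ∉ K) : v ∈ frontier K := by
  refine ⟨subset_closure hv, fun hi => ?_⟩
  have hc : Tendsto (fun ε : ℝ => v + ε • d) (𝓝[>] 0) (𝓝 v) := by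
    have : Tendsto (fun ε : ℝ => v + ε • d) (𝓝 0) (𝓝 (v + (0 : ℝ) • d)) :=
      Continuous.tendsto (by fun_prop) 0
    rw [zero_smul, add_zero] at this
    exact this.mono_left nhdsWithin_le_nhds
  obtain ⟨ε, hε, hε0⟩ := ((hc.eventually (isOpen_interior.mem_nhds hi)).and
    self_mem_nhdsWithin).exists
  exact h ε hε0 (interior_subset hε)

/-! ### An explicit cone with distortion below `π / 2` -/

section Polar

theorem norm_smul_sub_smul_sq {a b : ℂ} (ha : ‖a‖ = 1) (hb : ‖b‖ = 1) (r s : ℝ) :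
    ‖r • a - s • b‖ ^ 2 = (r - s) ^ 2 + r * s * ‖a - b‖ ^ 2 := by
  rw [@norm_sub_sq_real ℂ, @norm_sub_sq_real ℂ, norm_smul, norm_smul, ha, hb,
    real_inner_smul_left, real_inner_smul_right, Real.norm_eq_abs, Real.norm_eq_abs, mul_one,
    mul_one, sq_abs, sq_abs]
  ring

/-- The cofactor of `a - b` is a sum of six products of norm one. The sixth power wraps the unrolled
cone, a sector of angle `2π / 6`, around the axis. -/
theorem norm_pow_six_sub_le {a b : ℂ} (ha : ‖a‖ = 1) (hb : ‖b‖ = 1) :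
    ‖a ^ 6 - b ^ 6‖ ≤ 6 * ‖a - b‖ := by
  have h : a ^ 6 - b ^ 6 = (a ^ 5 + a ^ 4 * b + a ^ 3 * b ^ 2 + a ^ 2 * b ^ 3 + a * b ^ 4 + b ^ 5)
      * (a - b) := by ring
  rw [h, norm_mul]
  gcongr
  refine (norm_add_le _ _).trans ?_
  refine (add_le_add_left (norm_add_le _ _) _).trans ?_
  refine (add_le_add_left (add_le_add_left (norm_add_le _ _) _) _).trans ?_
  refine (add_le_add_left (add_le_add_left (add_le_add_left (norm_add_le _ _) _) _) _).trans ?_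
  refine (add_le_add_left (add_le_add_left (add_le_add_left (add_le_add_left
    (norm_add_le _ _) _) _) _) _).trans ?_
  simp only [norm_mul, norm_pow, ha, hb]
  norm_num

/-- `v` is the bisecting direction and `2y` the signed angle from `z` to `w`, chosen in `(-π, π]`.
-/
theorem exists_symmetric_polar (z w : ℂ) : ∃ (v : Circle) (y : ℝ), |y| ≤ Real.pi / 2 ∧
    z = ‖z‖ • (v * Circle.exp (-y) : ℂ) ∧ w = ‖w‖ • (v * Circle.exp y : ℂ) := by
  have hpol : ∀ z : ℂ, z = ‖z‖ • (Circle.exp z.arg : ℂ) := fun z => by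
    rw [Circle.coe_exp, Complex.real_smul, Complex.norm_mul_exp_arg_mul_I]
  set θ := (Circle.exp (w.arg - z.arg) : ℂ).arg with hθ
  have hexp : Circle.exp θ = Circle.exp (w.arg - z.arg) := Circle.exp_arg _
  refine ⟨Circle.exp (z.arg + θ / 2), θ / 2, ?_, ?_, ?_⟩
  · rw [abs_div, abs_of_pos (two_pos : (0 : ℝ) < 2)]
    have := Complex.abs_arg_le_pi (Circle.exp (w.arg - z.arg) : ℂ)
    gcongr
  · rw [← Circle.coe_mul, ← Circle.exp_add]
    conv_lhs => rw [hpol z]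
    ring_nf
  · rw [← Circle.coe_mul, ← Circle.exp_add, add_assoc, add_halves, Circle.exp_add, hexp,
      ← Circle.exp_add, add_sub_cancel]
    exact hpol w

theorem norm_circleExp_neg_sub_sq (y : ℝ) :
    ‖(Circle.exp (-y) : ℂ) - Circle.exp y‖ ^ 2 = 4 * Real.sin y ^ 2 := by
  rw [Circle.coe_exp, Circle.coe_exp, ← Complex.normSq_eq_norm_sq, Complex.normSq_apply]
  simp [Complex.exp_re, Complex.exp_im]
  ring

/-- With `t = y / 6`, `sin y = 2 sin t (3 - 4 sin² t) cos 3t`, where the second factor is at least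
`1 + √3` and the last at least `√2 / 2`. The worst case is `y = ± π / 2`, with ratio `6 sin (π / 12)
≈ 1.553`. -/
theorem sin_div_six_sq_le {y : ℝ} (hy : |y| ≤ Real.pi / 2) :
    36 * Real.sin (y / 6) ^ 2 ≤ (1.56 : ℝ) ^ 2 * Real.sin y ^ 2 := by
  set t := y / 6 with ht
  have hpi := Real.pi_pos
  have ht' : |t| ≤ Real.pi / 12 := by
    rw [ht, abs_div, abs_of_pos (by norm_num : (0 : ℝ) < 6)]
    linarith
  have hy6 : y = 2 * (3 * t) := by rw [ht]; ring
  have hc3 : √2 / 2 ≤ Real.cos (3 * t) := by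
    rw [← Real.cos_pi_div_four, ← Real.cos_abs (3 * t), abs_mul, abs_of_pos three_pos]
    exact Real.cos_le_cos_of_nonneg_of_le_pi (by positivity) (by linarith) (by linarith)
  have hc2 : √3 / 2 ≤ Real.cos (2 * t) := by
    rw [← Real.cos_pi_div_six, ← Real.cos_abs (2 * t), abs_mul, abs_of_pos two_pos]
    exact Real.cos_le_cos_of_nonneg_of_le_pi (by positivity) (by linarith) (by linarith)
  have hcs : Real.cos (2 * t) = 1 - 2 * Real.sin t ^ 2 := by
    rw [Real.cos_two_mul, Real.cos_sq']
    ring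
  have h2 : (1.414 : ℝ) ≤ √2 := Real.le_sqrt_of_sq_le (by norm_num)
  have h3 : (1.732 : ℝ) ≤ √3 := Real.le_sqrt_of_sq_le (by norm_num)
  rw [hy6, Real.sin_two_mul, Real.sin_three_mul]
  set s := Real.sin t
  set c := Real.cos (3 * t)
  have hs : (2.732 : ℝ) ≤ 3 - 4 * s ^ 2 := by linarith
  have hc : (0.707 : ℝ) ≤ c := by linarith
  have hprod : (2.732 : ℝ) * 0.707 ≤ (3 - 4 * s ^ 2) * c := by gcongr
  have hsq : ((2.732 : ℝ) * 0.707) ^ 2 ≤ ((3 - 4 * s ^ 2) * c) ^ 2 := by gcongr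
  have e : (2 * (3 * s - 4 * s ^ 3) * c) ^ 2 = 4 * s ^ 2 * ((3 - 4 * s ^ 2) * c) ^ 2 := by ring
  rw [e]
  nlinarith [sq_nonneg s]

end Polar

/-- A circular cone with half-angle `arcsin (1 / 6)` has distortion less than `π / 2`. -/
theorem exists_convex_distortion_le : ∃ K : Set E3, Convex ℝ K ∧ IsCompact K ∧
    (interior K).Nonempty ∧ distortion (frontier K) ≤ ENNReal.ofReal 1.56 := by
  obtain ⟨e, he⟩ : ∃ e : E3, ‖e‖ = 1 := exists_norm_eq E3 zero_le_one
  obtain ⟨j, P, hj, hPj, hPe, hadj, hdec⟩ := exists_axis_coordinates he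
  have hee : inner ℝ e e = (1 : ℝ) := by rw [real_inner_self_eq_norm_sq, he, one_pow]
  have hnorm : ∀ v, ‖v‖ ^ 2 = inner ℝ e v ^ 2 + ‖P v‖ ^ 2 := by
    intro v
    conv_lhs => rw [hdec v]
    rw [norm_add_sq_real, real_inner_smul_left, hj, norm_smul, he, j.norm_map, mul_one,
      Real.norm_eq_abs, sq_abs]
    ring
  -- Height `√35` over a base of radius `1` gives slant length `6`. The apex is the origin and the
  -- base lies at height `q`.
  set q : ℝ := √35 with hq
  have hqpos : 0 < q := by positivity
  have hq2 : q ^ 2 = 35 := Real.sq_sqrt (by norm_num)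
  set pt : ℂ → ℝ → E3 := fun z h => h • e + j z with hpt
  have hpte : ∀ z h, inner ℝ e (pt z h) = h := fun z h => by
    simp only [hpt]
    rw [inner_add_right, inner_smul_right, hee, hj, mul_one, add_zero]
  have hptP : ∀ z h, P (pt z h) = z := fun z h => by
    simp only [hpt]
    rw [map_add, map_smul, hPe, hPj, smul_zero, zero_add]
  have hptdist : ∀ z h z' h', ‖pt z h - pt z' h'‖ ^ 2 = (h - h') ^ 2 + ‖z - z'‖ ^ 2 := by
    intro z h z' h'
    rw [hnorm, inner_sub_right, map_sub, hpte, hpte, hptP, hptP]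
  have hptv : ∀ v, v = pt (P v) (inner ℝ e v) := hdec
  set K : Set E3 := {v | q * ‖P v‖ ≤ inner ℝ e v ∧ inner ℝ e v ≤ q} with hK
  have hmemK : ∀ v, v ∈ K ↔ q * ‖P v‖ ≤ inner ℝ e v ∧ inner ℝ e v ≤ q := fun v => Iff.rfl
  have hc1 : Continuous fun v : E3 => q * ‖P v‖ := by fun_prop
  have hc2 : Continuous fun v : E3 => (inner ℝ e v : ℝ) := by fun_prop
  have hclosed : IsClosed K :=
    IsClosed.inter (isClosed_le hc1 hc2) (isClosed_le hc2 continuous_const)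
  have hconv : Convex ℝ K := by
    intro x hx y hy a b ha hb hab
    rw [hmemK] at hx hy ⊢
    rw [inner_add_right, inner_smul_right, inner_smul_right, map_add, map_smul, map_smul]
    have h1 := norm_add_le (a • P x) (b • P y)
    rw [norm_smul, norm_smul, Real.norm_eq_abs, Real.norm_eq_abs, abs_of_nonneg ha,
      abs_of_nonneg hb] at h1
    have h2 := mul_le_mul_of_nonneg_left hx.1 ha
    have h3 := mul_le_mul_of_nonneg_left hy.1 hb
    have h4 := mul_le_mul_of_nonneg_left hx.2 ha
    have h5 := mul_le_mul_of_nonneg_left hy.2 hb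
    have h6 := mul_le_mul_of_nonneg_left h1 hqpos.le
    have h7 : a * q + b * q = q := by rw [← add_mul, hab, one_mul]
    constructor <;> linarith
  have hP1 : ∀ v ∈ K, ‖P v‖ ≤ 1 := by
    intro v hv
    have := hv.1.trans hv.2
    by_contra! hlt
    nlinarith
  have hcomp : IsCompact K := by
    refine isCompact_of_isClosed_isBounded hclosed
      ((isBounded_closedBall (x := (0 : E3)) (r := 6)).subset fun v hv => ?_)
    rw [mem_closedBall, dist_zero_right]
    refine le_of_sq_le_sq ?_ (by norm_num)
    have h1 := hP1 v hv
    have h2 : 0 ≤ inner ℝ e v := le_trans (by positivity) hv.1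
    rw [hnorm]
    nlinarith [hv.2, norm_nonneg (P v)]
  have hopen : ∀ v, q * ‖P v‖ < inner ℝ e v → inner ℝ e v < q → v ∈ interior K := by
    intro v h1 h2
    refine interior_maximal (t := {v | q * ‖P v‖ < inner ℝ e v} ∩ {v | inner ℝ e v < q})
      (fun u hu => (hmemK u).2 ⟨le_of_lt hu.1, le_of_lt hu.2⟩) ?_ ⟨h1, h2⟩
    exact (isOpen_lt hc1 hc2).inter (isOpen_lt hc2 continuous_const)
  have hint : (interior K).Nonempty := by
    refine ⟨pt 0 (q / 2), hopen _ ?_ ?_⟩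
    · rw [hptP, hpte, norm_zero, mul_zero]
      positivity
    · rw [hpte]
      linarith
  have hbase : ∀ w : ℂ, ‖w‖ ≤ 1 → pt w q ∈ frontier K := by
    intro w hw
    refine mem_frontier_of_forall_add_smul_notMem (d := e) ?_ fun ε hε hm => ?_
    · rw [hmemK, hptP, hpte]
      exact ⟨by nlinarith, le_rfl⟩
    · have := hm.2
      rw [inner_add_right, hpte, inner_smul_right, hee] at this
      linarith
  have hlat : ∀ w : ℂ, ‖w‖ ≤ 1 → pt w (q * ‖w‖) ∈ frontier K := by
    intro w hw
    refine mem_frontier_of_forall_add_smul_notMem (d := -e) ?_ fun ε hε hm => ?_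
    · rw [hmemK, hptP, hpte]
      exact ⟨le_rfl, by nlinarith⟩
    · have := hm.1
      rw [inner_add_right, hpte, inner_smul_right, inner_neg_right, hee, map_add, hptP, map_smul,
        map_neg, hPe, neg_zero, smul_zero, add_zero] at this
      linarith
  have hcases : ∀ v ∈ frontier K, ∃ w : ℂ, ‖w‖ ≤ 1 ∧ (v = pt w q ∨ v = pt w (q * ‖w‖)) := by
    intro v hv
    have hvK := hclosed.frontier_subset hv
    refine ⟨P v, hP1 v hvK, ?_⟩
    rcases hvK.2.lt_or_eq with h1 | h1
    · rcases hvK.1.lt_or_eq with h2 | h2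
      · exact absurd (hopen v h2 h1) hv.2
      · right
        rw [h2]
        exact hptv v
    · left
      conv_rhs => rw [← h1]
      exact hptv v
  have hbb : ∀ w w' : ℂ, ‖w‖ ≤ 1 → ‖w'‖ ≤ 1 →
      intrinsicEDist (frontier K) (pt w q) (pt w' q) ≤ edist (pt w q) (pt w' q) := by
    intro w w' hw hw'
    refine intrinsicEDist_le_of_segment ?_
    rintro _ ⟨a, b, ha, hb, hab, rfl⟩
    have h1 : a • pt w q + b • pt w' q = pt (a • w + b • w') q := by
      simp only [hpt]
      rw [map_add, map_smul, map_smul]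
      calc _ = (a + b) • q • e + (a • j w + b • j w') := by
            rw [add_smul, smul_add, smul_add]; abel
        _ = _ := by rw [hab, one_smul]
    rw [h1]
    refine hbase _ ?_
    have := (convex_closedBall (0 : ℂ) 1) (mem_closedBall_zero_iff.2 hw)
      (mem_closedBall_zero_iff.2 hw') ha hb hab
    exact mem_closedBall_zero_iff.1 this
  have hbl : ∀ w z : ℂ, ‖w‖ ≤ 1 → ‖z‖ ≤ 1 →
      intrinsicEDist (frontier K) (pt w q) (pt z (q * ‖z‖))
        ≤ ENNReal.ofReal (1.56 * ‖pt w q - pt z (q * ‖z‖)‖) := by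
    intro w z hw hz
    set s := ‖z‖ with hs
    have hs0 : 0 ≤ s := norm_nonneg _
    -- `u` is the rim end of the generator through `z`; the route crosses the base from `w` to `u`
    -- and then follows the generator.
    obtain ⟨u, hu⟩ : ∃ u : Circle, z = s • (u : ℂ) := ⟨Circle.exp z.arg, by
      rw [Circle.coe_exp, Complex.real_smul, Complex.norm_mul_exp_arg_mul_I]⟩
    have hu1 : ‖(u : ℂ)‖ = 1 := u.norm_coe
    have hray : ∀ t : ℝ, t • pt u q = pt (t • (u : ℂ)) (q * t) := fun t => by
      simp only [hpt]
      rw [smul_add, smul_smul, map_smul, mul_comm]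
    have h2 : intrinsicEDist (frontier K) (pt u q) (pt z (q * s))
        ≤ edist (pt u q) (pt z (q * s)) := by
      refine intrinsicEDist_le_of_segment ?_
      rintro _ ⟨a, b, ha, hb, hab, rfl⟩
      have h1 : a • pt u q + b • pt z (q * s) = pt ((a + b * s) • (u : ℂ)) (q * (a + b * s)) := by
        rw [← hray, hu, ← hray, smul_smul, ← add_smul]
      have h3 : 0 ≤ a + b * s := by positivity
      have h4 : ‖(a + b * s) • (u : ℂ)‖ = a + b * s := by
        rw [norm_smul, hu1, mul_one, Real.norm_eq_abs, abs_of_nonneg h3]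
      rw [h1]
      have h5 := hlat ((a + b * s) • (u : ℂ)) (by rw [h4]; nlinarith)
      rwa [h4] at h5
    refine (intrinsicEDist_triangle.trans (add_le_add (hbb w u hw hu1.le) h2)).trans ?_
    rw [edist_dist, edist_dist, ← ENNReal.ofReal_add dist_nonneg dist_nonneg, dist_eq_norm,
      dist_eq_norm]
    refine ENNReal.ofReal_le_ofReal (le_of_sq_le_sq ?_ (by positivity))
    set α := ‖w - u‖ with hα
    have hα0 : 0 ≤ α := norm_nonneg _
    have e1 : ‖pt w q - pt u q‖ = α := by
      have := hptdist w q u q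
      rw [sub_self, zero_pow two_ne_zero, zero_add] at this
      exact (pow_left_inj₀ (norm_nonneg _) hα0 two_ne_zero).1 this
    have e2 : ‖pt u q - pt z (q * s)‖ = 6 * (1 - s) := by
      have h1 := hptdist u q z (q * s)
      have h3 : ‖(u : ℂ) - z‖ = 1 - s := by
        have : (u : ℂ) - z = (1 - s) • (u : ℂ) := by rw [sub_smul, one_smul, ← hu]
        rw [this, norm_smul, hu1, mul_one, Real.norm_eq_abs, abs_of_nonneg (by linarith)]
      rw [h3] at h1
      refine (pow_left_inj₀ (norm_nonneg _) (by linarith) two_ne_zero).1 ?_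
      rw [h1]
      have : (q - q * s) ^ 2 = q ^ 2 * (1 - s) ^ 2 := by ring
      rw [this, hq2]
      ring
    have e3 : α ^ 2 - 2 * (1 - s) * α + 36 * (1 - s) ^ 2 ≤ ‖pt w q - pt z (q * s)‖ ^ 2 := by
      rw [hptdist]
      have h1 : w - z = (w - u) + (1 - s) • (u : ℂ) := by
        rw [sub_smul, one_smul, ← hu]
        ring
      have h3 := (abs_le.1 (abs_real_inner_le_norm (w - u) (u : ℂ))).1
      rw [hu1, mul_one, ← hα] at h3
      rw [h1, @norm_add_sq_real ℂ, inner_smul_right, norm_smul, hu1, mul_one, Real.norm_eq_abs,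
        sq_abs, ← hα]
      have : (q - q * s) ^ 2 = q ^ 2 * (1 - s) ^ 2 := by ring
      rw [this, hq2]
      nlinarith
    -- With `β = 6 (1 - s)` the claim is `(α + β)² ≤ 1.56² (α² - αβ / 3 + β²)`; the extreme case is
    -- `α = β`, with ratio `12 / 5`.
    rw [e1, e2, mul_pow]
    nlinarith [sq_nonneg (α - 6 * (1 - s)), mul_nonneg hα0 (by linarith : 0 ≤ 1 - s)]
  have hll : ∀ z w : ℂ, ‖z‖ ≤ 1 → ‖w‖ ≤ 1 →
      intrinsicEDist (frontier K) (pt z (q * ‖z‖)) (pt w (q * ‖w‖))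
        ≤ ENNReal.ofReal (1.56 * ‖pt z (q * ‖z‖) - pt w (q * ‖w‖)‖) := by
    intro z w hz hw
    obtain ⟨v, y, hy, hzv, hwv⟩ := exists_symmetric_polar z w
    set Λ : ℂ → E3 := fun z => pt z (q * ‖z‖) with hΛ
    have hΛd : ∀ (r s : ℝ), 0 ≤ r → 0 ≤ s → ∀ a b : ℂ, ‖a‖ = 1 → ‖b‖ = 1 →
        ‖Λ (r • a) - Λ (s • b)‖ ^ 2 = 36 * (r - s) ^ 2 + r * s * ‖a - b‖ ^ 2 := by
      intro r s hr hs a b ha hb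
      simp only [hΛ]
      rw [hptdist, norm_smul_sub_smul_sq ha hb, norm_smul, norm_smul, ha, hb, Real.norm_eq_abs,
        Real.norm_eq_abs, abs_of_nonneg hr, abs_of_nonneg hs]
      have : (q * (r * 1) - q * (s * 1)) ^ 2 = q ^ 2 * (r - s) ^ 2 := by ring
      rw [this, hq2]
      ring
    -- `Φ` rolls the plane onto the cone: radii are divided by `6` and angles multiplied by `6`. It
    -- is 1-Lipschitz, so a straight segment in the unrolled picture gives a short path on the cone.
    -- At `ζ = 0` the radial factor makes the value of the quotient irrelevant.
    set Φ : ℂ → E3 := fun ζ => Λ ((‖ζ‖ / 6) • (v * (ζ / ‖ζ‖) ^ 6 : ℂ)) with hΦ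
    have hv1 : ‖(v : ℂ)‖ = 1 := v.norm_coe
    have hΦpol : ∀ (r : ℝ) (a : ℂ), 0 ≤ r → ‖a‖ = 1 →
        Φ (r • a) = Λ ((r / 6) • (v * a ^ 6 : ℂ)) := by
      intro r a hr ha
      simp only [hΦ]
      rw [norm_smul, ha, mul_one, Real.norm_eq_abs, abs_of_nonneg hr]
      rcases hr.eq_or_lt with h | h
      · rw [← h]
        simp
      · rw [Complex.real_smul (x := r), mul_div_cancel_left₀]
        exact_mod_cast h.ne'
    have hpol : ∀ ζ : ℂ, ∃ (r : ℝ) (a : ℂ), 0 ≤ r ∧ ‖a‖ = 1 ∧ ζ = r • a := fun ζ =>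
      ⟨‖ζ‖, Circle.exp ζ.arg, norm_nonneg _, Circle.norm_coe _, by
        rw [Circle.coe_exp, Complex.real_smul, Complex.norm_mul_exp_arg_mul_I]⟩
    have hunit : ∀ a : ℂ, ‖a‖ = 1 → ‖(v * a ^ 6 : ℂ)‖ = 1 := fun a ha => by
      rw [norm_mul, norm_pow, ha, hv1, one_pow, one_mul]
    have hΦlip : LipschitzWith 1 Φ := by
      refine LipschitzWith.of_dist_le_mul fun ζ ζ' => ?_
      rw [NNReal.coe_one, one_mul, dist_eq_norm, dist_eq_norm]
      obtain ⟨r, a, hr, ha, rfl⟩ := hpol ζ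
      obtain ⟨s, b, hs, hb, rfl⟩ := hpol ζ'
      refine le_of_sq_le_sq ?_ (norm_nonneg _)
      rw [hΦpol r a hr ha, hΦpol s b hs hb, hΛd _ _ (by positivity) (by positivity) _ _
        (hunit a ha) (hunit b hb), norm_smul_sub_smul_sq ha hb, ← mul_sub, norm_mul, hv1, one_mul]
      have h1 := norm_pow_six_sub_le ha hb
      have h2 : ‖a ^ 6 - b ^ 6‖ ^ 2 ≤ (6 * ‖a - b‖) ^ 2 := by gcongr
      have h3 := mul_le_mul_of_nonneg_left h2 (mul_nonneg hr hs)
      nlinarith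
    have hpow : ∀ t : ℝ, (Circle.exp (t / 6) : ℂ) ^ 6 = Circle.exp t := by
      intro t
      rw [Circle.coe_exp, Circle.coe_exp, ← Complex.exp_nat_mul]
      congr 1
      push_cast
      ring
    have hend : ∀ (z : ℂ) (t : ℝ), z = ‖z‖ • (v * Circle.exp t : ℂ) →
        Φ ((6 * ‖z‖) • (Circle.exp (t / 6) : ℂ)) = Λ z := by
      intro z t hzt
      rw [hΦpol _ _ (by positivity) (Circle.norm_coe _), hpow, mul_div_cancel_left₀ _ (by norm_num)]
      rw [← hzt]
    set ζ₁ : ℂ := (6 * ‖z‖) • (Circle.exp (-y / 6) : ℂ) with hζ₁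
    set ζ₂ : ℂ := (6 * ‖w‖) • (Circle.exp (y / 6) : ℂ) with hζ₂
    have hn1 : ‖ζ₁‖ ≤ 6 := by
      rw [hζ₁, norm_smul, Circle.norm_coe, Real.norm_eq_abs, abs_of_nonneg (by positivity)]
      linarith
    have hn2 : ‖ζ₂‖ ≤ 6 := by
      rw [hζ₂, norm_smul, Circle.norm_coe, Real.norm_eq_abs, abs_of_nonneg (by positivity)]
      linarith
    have hmaps : ∀ ζ ∈ segment ℝ ζ₁ ζ₂, Φ ζ ∈ frontier K := by
      intro ζ hζ
      have h1 : ‖ζ‖ ≤ 6 := mem_closedBall_zero_iff.1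
        ((convex_closedBall (0 : ℂ) 6).segment_subset (mem_closedBall_zero_iff.2 hn1)
          (mem_closedBall_zero_iff.2 hn2) hζ)
      obtain ⟨r, a, hr, ha, rfl⟩ := hpol ζ
      rw [norm_smul, ha, mul_one, Real.norm_eq_abs, abs_of_nonneg hr] at h1
      rw [hΦpol r a hr ha]
      refine hlat _ ?_
      rw [norm_smul, hunit a ha, mul_one, Real.norm_eq_abs, abs_of_nonneg (by positivity)]
      linarith
    obtain ⟨γ, hγ, hγl⟩ := exists_path_segment ζ₁ ζ₂
    obtain ⟨γ', h1, h2⟩ := exists_path_comp_le γ hγ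
      (hΦlip.lipschitzOnWith (s := segment ℝ ζ₁ ζ₂))
    have h3 : intrinsicEDist (frontier K) (Φ ζ₁) (Φ ζ₂) ≤ edist ζ₁ ζ₂ := by
      refine (intrinsicEDist_le γ' fun t => by rw [h1]; exact hmaps _ (hγ t)).trans ?_
      refine h2.trans ?_
      rw [ENNReal.coe_one, one_mul]
      exact hγl
    rw [hend z (-y) hzv, hend w y hwv] at h3
    refine h3.trans ?_
    rw [edist_dist, dist_eq_norm]
    refine ENNReal.ofReal_le_ofReal (le_of_sq_le_sq ?_ (by positivity))
    change _ ≤ (1.56 * ‖Λ z - Λ w‖) ^ 2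
    have h4 : ‖Λ z - Λ w‖ ^ 2 = 36 * (‖z‖ - ‖w‖) ^ 2 + ‖z‖ * ‖w‖ * (4 * Real.sin y ^ 2) := by
      have hu : ∀ t, ‖(v * Circle.exp t : ℂ)‖ = 1 := fun t => by
        rw [norm_mul, hv1, Circle.norm_coe, one_mul]
      have h5 := hΛd ‖z‖ ‖w‖ (norm_nonneg _) (norm_nonneg _) _ _ (hu (-y)) (hu y)
      rw [← hzv, ← hwv, ← mul_sub, norm_mul, hv1, one_mul, norm_circleExp_neg_sub_sq] at h5
      exact h5
    rw [mul_pow, h4, hζ₁, hζ₂, norm_smul_sub_smul_sq (Circle.norm_coe _) (Circle.norm_coe _),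
      neg_div, norm_circleExp_neg_sub_sq]
    -- The squared unrolled and Euclidean distances share the radial term `36 (‖z‖ - ‖w‖)²`, so only
    -- the angular terms `36 sin² (y / 6)` and `sin² y` have to be compared.
    have h5 := mul_le_mul_of_nonneg_left (sin_div_six_sq_le hy)
      (mul_nonneg (norm_nonneg z) (norm_nonneg w))
    nlinarith [sq_nonneg (‖z‖ - ‖w‖)]
  refine ⟨K, hconv, hcomp, hint, distortion_le fun x hx y hy hxy => ?_⟩
  rw [edist_dist, ← ENNReal.ofReal_mul (by norm_num), dist_eq_norm]
  obtain ⟨z, hz, rfl | rfl⟩ := hcases x hx <;> obtain ⟨w, hw, rfl | rfl⟩ := hcases y hy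
  · refine (hbb z w hz hw).trans ?_
    rw [edist_dist, dist_eq_norm]
    refine ENNReal.ofReal_le_ofReal ?_
    nlinarith [norm_nonneg (pt z q - pt w q)]
  · exact hbl z w hz hw
  · rw [intrinsicEDist_comm, norm_sub_rev]
    exact hbl w z hw hz
  · exact hll z w hz hw

/-- A compact convex set with nonempty interior. -/
structure IsSolidConvex (K : Set E3) : Prop where
  convex : Convex ℝ K
  isCompact : IsCompact K
  nonempty_interior : (interior K).Nonempty

/-! ### Normalisation, semicontinuity and compactness -/

section Similarity

theorem distortion_image_le {A : Set E3} {f : E3 → E3} {c : ℝ≥0} (hc : c ≠ 0)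
    (hf : ∀ x y, edist (f x) (f y) = c * edist x y) : distortion (f '' A) ≤ distortion A := by
  refine distortion_le ?_
  rintro _ ⟨x, hx, rfl⟩ _ ⟨y, hy, rfl⟩ hxy
  have hlip : LipschitzOnWith c f A := fun x _ y _ => (hf x y).le
  refine (intrinsicEDist_map_le hc hlip (mapsTo_image f A)).trans ?_
  have h1 := intrinsicEDist_le_of_distortion_le le_rfl hx hy fun h => hxy (congrArg f h)
  calc c * intrinsicEDist A x y ≤ c * (distortion A * edist x y) := by gcongr
    _ = distortion A * edist (f x) (f y) := by rw [hf]; ring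

theorem IsSolidConvex.exists_normalised {K : Set E3} (hK : IsSolidConvex K) {c : E3} {r C : ℝ}
    (hr : 0 < r) (h1 : ball c r ⊆ K) (h2 : K ⊆ closedBall c (C * r)) :
    ∃ K' : Set E3, IsSolidConvex K' ∧ distortion (frontier K') ≤ distortion (frontier K) ∧
      closedBall 0 1 ⊆ K' ∧ K' ⊆ closedBall 0 C := by
  let h : E3 ≃ₜ E3 := (Homeomorph.addRight (-c)).trans
    (Homeomorph.smulOfNeZero r⁻¹ (inv_ne_zero hr.ne'))
  have hh : ∀ x, h x = r⁻¹ • (x - c) := fun x => by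
    rw [sub_eq_add_neg]
    rfl
  have hdist : ∀ x y, dist (h x) (h y) = r⁻¹ * dist x y := fun x y => by
    rw [hh, hh, dist_smul₀, Real.norm_eq_abs, abs_of_pos (inv_pos.2 hr), dist_sub_right]
  have hcomp : IsCompact (h '' K) := hK.isCompact.image h.continuous
  refine ⟨h '' K, ⟨?_, hcomp, ?_⟩, ?_, ?_, ?_⟩
  · have e : h '' K = r⁻¹ • ((fun x => -c + x) '' K) := by
      rw [← image_smul, image_image]
      refine image_congr fun x _ => ?_
      rw [hh, neg_add_eq_sub]
    rw [e]
    exact (hK.convex.translate (-c)).smul _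
  · rw [← h.image_interior]
    exact hK.nonempty_interior.image _
  · rw [← h.image_frontier]
    refine distortion_image_le (c := Real.toNNReal r⁻¹) ?_ fun x y => ?_
    · simpa using hr
    · rw [edist_dist, hdist, ENNReal.ofReal_mul (inv_pos.2 hr).le, edist_dist]
      rfl
  · rw [← closure_ball (0 : E3) one_ne_zero]
    refine closure_minimal (fun x hx => ?_) hcomp.isClosed
    rw [mem_ball_zero_iff] at hx
    refine ⟨c + r • x, h1 ?_, ?_⟩
    · rw [mem_ball, dist_eq_norm, add_sub_cancel_left, norm_smul, Real.norm_eq_abs, abs_of_pos hr]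
      nlinarith
    · rw [hh, add_sub_cancel_left, smul_smul, inv_mul_cancel₀ hr.ne', one_smul]
  · rintro _ ⟨x, hx, rfl⟩
    have := h2 hx
    rw [mem_closedBall, dist_eq_norm] at this
    rw [mem_closedBall_zero_iff, hh, norm_smul, Real.norm_eq_abs, abs_of_pos (inv_pos.2 hr),
      inv_mul_le_iff₀ hr, mul_comm]
    exact this

end Similarity

section Semicontinuity

/-- The intrinsic distance on the boundary of `K` is controlled by the distortion of the boundary
of a body close to `K`. -/
theorem IsSolidConvex.intrinsicEDist_le {K K' : Set E3} (hK : IsSolidConvex K)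
    (hK' : IsSolidConvex K') {ε R d : ℝ} (hε : 0 < ε) (hε1 : ε < 1) (hd : 0 ≤ d)
    (h1 : ∀ x ∈ K, (1 - ε) • x ∈ K') (h2 : ∀ x ∈ K', (1 + ε)⁻¹ • x ∈ K)
    (hR : ∀ x ∈ K, ‖x‖ ≤ R) (hdist : distortion (frontier K') ≤ ENNReal.ofReal d) {p q : E3}
    (hp : p ∈ frontier K) (hq : q ∈ frontier K) (hpq : p ≠ q) :
    intrinsicEDist (frontier K) p q ≤
      ENNReal.ofReal (d * (‖p - q‖ + 4 * ε * R / (1 - ε))) := by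
  have hμ : 0 < 1 - ε := by linarith
  set C : Set E3 := (1 - ε) • K with hC
  have hCc : Convex ℝ C := hK.convex.smul _
  have hCcl : IsClosed C := hK.isCompact.isClosed.smul₀ _
  have hCint : (interior C).Nonempty := by
    rw [hC, interior_smul₀ hμ.ne']
    exact hK.nonempty_interior.smul_set
  have hCK' : C ⊆ K' := by
    rintro _ ⟨x, hx, rfl⟩
    exact h1 x hx
  obtain ⟨π, hπ⟩ := exists_isMetricProj (hCint.mono interior_subset) hCcl.isComplete hCc
  have hlift : ∀ x ∈ frontier K, ∃ x' ∈ frontier K', π x' = (1 - ε) • x := by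
    intro x hx
    refine hπ.exists_mem_frontier_of_subset hCc hCcl hCint hCK' hK'.isCompact.isBounded ?_
    rw [hC, frontier_smul_of_ne_zero hμ.ne']
    exact smul_mem_smul_set hx
  -- Writing `x' = (1 + ε) k` with `k ∈ K`, the point `(1 - ε) k` of `C` is at distance `2 ε ‖k‖`
  -- from `x'`.
  have hnear : ∀ x' ∈ frontier K', ‖x' - π x'‖ ≤ 2 * ε * R := by
    intro x' hx'
    have hk := h2 x' (hK'.isCompact.isClosed.frontier_subset hx')
    set k := (1 + ε)⁻¹ • x' with hkdef
    have hx'k : x' = (1 + ε) • k := by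
      rw [hkdef, smul_smul, mul_inv_cancel₀ (by linarith), one_smul]
    refine (hπ.norm_sub_le x' (smul_mem_smul_set (a := 1 - ε) hk)).trans ?_
    have e : x' - (1 - ε) • k = (2 * ε) • k := by
      rw [hx'k]
      module
    rw [e, norm_smul, Real.norm_eq_abs, abs_of_pos (by positivity)]
    have := hR k hk
    gcongr
  obtain ⟨p', hp', hpp⟩ := hlift p hp
  obtain ⟨q', hq', hqq⟩ := hlift q hq
  have hne : p' ≠ q' := by
    rintro rfl
    rw [hpp] at hqq
    exact hpq (smul_right_injective E3 hμ.ne' hqq)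
  have hnorm : ‖p' - q'‖ ≤ (1 - ε) * ‖p - q‖ + 4 * ε * R := by
    have e : p' - q' = (p' - π p') + (1 - ε) • (p - q) - (q' - π q') := by
      rw [hpp, hqq]
      module
    have h3 := norm_sub_le ((p' - π p') + (1 - ε) • (p - q)) (q' - π q')
    have h4 := norm_add_le (p' - π p') ((1 - ε) • (p - q))
    rw [norm_smul, Real.norm_eq_abs, abs_of_pos hμ] at h4
    rw [← e] at h3
    linarith [hnear p' hp', hnear q' hq']
  have hlip : LipschitzWith (Real.toNNReal (1 - ε)⁻¹) fun v : E3 => (1 - ε)⁻¹ • π v := by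
    refine LipschitzWith.of_dist_le_mul fun u v => ?_
    rw [dist_smul₀, Real.norm_eq_abs, abs_of_pos (inv_pos.2 hμ),
      Real.coe_toNNReal _ (inv_pos.2 hμ).le]
    have h3 := hπ.lipschitz.dist_le_mul u v
    rw [NNReal.coe_one, one_mul] at h3
    have := inv_pos.2 hμ
    gcongr
  have hmaps : MapsTo (fun v : E3 => (1 - ε)⁻¹ • π v) (frontier K') (frontier K) := by
    intro v hv
    have h4 := hπ.mem_frontier fun hi => hv.2 (interior_mono hCK' hi)
    rw [hC, frontier_smul_of_ne_zero hμ.ne'] at h4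
    obtain ⟨z, hz, hzz⟩ := h4
    have hzz' : (1 - ε) • z = π v := hzz
    change (1 - ε)⁻¹ • π v ∈ _
    rw [← hzz', smul_smul, inv_mul_cancel₀ hμ.ne', one_smul]
    exact hz
  have h3 := intrinsicEDist_map_le (p := p') (q := q') (C := Real.toNNReal (1 - ε)⁻¹)
    (by simpa using hε1) hlip.lipschitzOnWith hmaps
  simp only [hpp, hqq] at h3
  rw [smul_smul, smul_smul, inv_mul_cancel₀ hμ.ne', one_smul, one_smul] at h3
  refine h3.trans ?_
  have h4 := intrinsicEDist_le_of_distortion_le hdist hp' hq' hne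
  rw [edist_dist, ← ENNReal.ofReal_mul hd, dist_eq_norm] at h4
  refine (mul_le_mul_right h4 _).trans ?_
  change ENNReal.ofReal (1 - ε)⁻¹ * _ ≤ _
  rw [← ENNReal.ofReal_mul (inv_pos.2 hμ).le]
  refine ENNReal.ofReal_le_ofReal ?_
  have h5 : d * (‖p - q‖ + 4 * ε * R / (1 - ε))
      = (1 - ε)⁻¹ * (d * ((1 - ε) * ‖p - q‖ + 4 * ε * R)) := by
    field_simp
  rw [h5]
  have := inv_pos.2 hμ
  gcongr

/-- `(1 + ε)⁻¹ • x` is a convex combination of `y` and the point `ε⁻¹ • (x - y)` of the unit ball.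
This converts Hausdorff closeness into inclusions up to scaling. -/
theorem inv_smul_mem_of_near {A : Set E3} (hA : Convex ℝ A) (hball : closedBall 0 1 ⊆ A)
    {ε : ℝ} (hε : 0 < ε) {x y : E3} (hy : y ∈ A) (hxy : dist x y ≤ ε) : (1 + ε)⁻¹ • x ∈ A := by
  have hb : ε⁻¹ • (x - y) ∈ A := by
    refine hball ?_
    rw [mem_closedBall_zero_iff, norm_smul, norm_inv, Real.norm_eq_abs, abs_of_pos hε,
      inv_mul_le_iff₀ hε, mul_one, ← dist_eq_norm]
    exact hxy
  have := hA hy hb (a := (1 + ε)⁻¹) (b := (1 + ε)⁻¹ * ε) (by positivity) (by positivity)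
    (by field_simp)
  convert this using 1
  rw [smul_smul, mul_assoc, mul_inv_cancel₀ hε.ne', mul_one]
  module

theorem smul_mem_of_near {A : Set E3} (hA : Convex ℝ A) (hball : closedBall 0 1 ⊆ A)
    {ε : ℝ} (hε : 0 < ε) (hε1 : ε < 1) {x y : E3} (hy : y ∈ A) (hxy : dist x y ≤ ε) :
    (1 - ε) • x ∈ A := by
  have h0 : (0 : E3) ∈ A := hball (by simp)
  have h1 := hA.smul_mem_of_zero_mem h0 (inv_smul_mem_of_near hA hball hε hy hxy)
    (t := (1 - ε) * (1 + ε)) ⟨mul_nonneg (by linarith) (by linarith), by nlinarith [sq_nonneg ε]⟩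
  rwa [smul_smul, mul_assoc, mul_inv_cancel₀ (by linarith), mul_one] at h1

/-- Blaschke's selection theorem for bodies between two fixed balls. -/
theorem exists_limit_of_isSolidConvex {C : ℝ} {K : ℕ → Set E3} (hK : ∀ n, IsSolidConvex (K n))
    (h1 : ∀ n, closedBall 0 1 ⊆ K n) (h2 : ∀ n, K n ⊆ closedBall 0 C) :
    ∃ L : Set E3, IsSolidConvex L ∧ ∀ ε : ℝ, 0 < ε → ε < 1 → ∀ N : ℕ, ∃ n ≥ N,
      (∀ x ∈ L, (1 - ε) • x ∈ K n) ∧ ∀ x ∈ K n, (1 + ε)⁻¹ • x ∈ L := by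
  let S : ℕ → TopologicalSpace.NonemptyCompacts E3 := fun n =>
    ⟨⟨K n, (hK n).isCompact⟩, (hK n).nonempty_interior.mono interior_subset⟩
  have hS : ∀ n, (S n : Set E3) = K n := fun n => rfl
  obtain ⟨L, -, φ, hφ, hlim⟩ := (TopologicalSpace.NonemptyCompacts.isCompact_subsets_of_isCompact
    (isCompact_closedBall (0 : E3) C)).tendsto_subseq (x := S) fun n => h2 n
  have hnear : ∀ ε : ℝ, 0 < ε → ∀ N : ℕ, ∃ n ≥ N,
      (∀ x ∈ (L : Set E3), ∃ y ∈ K n, dist x y ≤ ε) ∧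
      ∀ x ∈ K n, ∃ y ∈ (L : Set E3), dist x y ≤ ε := by
    intro ε hε N
    obtain ⟨n, hn, hnN⟩ := ((Metric.tendsto_nhds.1 hlim ε hε).and
      (eventually_ge_atTop N)).exists
    rw [Function.comp_apply, Metric.NonemptyCompacts.dist_eq, hS] at hn
    have hfin : hausdorffEDist (K (φ n)) (L : Set E3) ≠ ⊤ :=
      hausdorffEDist_ne_top_of_nonempty_of_bounded ((hK _).nonempty_interior.mono interior_subset)
        L.nonempty (hK _).isCompact.isBounded L.isCompact.isBounded
    refine ⟨φ n, hnN.trans (hφ.id_le n), fun x hx => ?_, fun x hx => ?_⟩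
    · obtain ⟨y, hy, hxy⟩ := exists_dist_lt_of_hausdorffDist_lt' hx hn hfin
      exact ⟨y, hy, by rw [dist_comm]; exact hxy.le⟩
    · obtain ⟨y, hy, hxy⟩ := exists_dist_lt_of_hausdorffDist_lt hx hn hfin
      exact ⟨y, hy, hxy.le⟩
  have hLcl : IsClosed (L : Set E3) := L.isCompact.isClosed
  have hball : closedBall 0 1 ⊆ (L : Set E3) := by
    intro x hx
    rw [← hLcl.closure_eq, Metric.mem_closure_iff]
    intro ε hε
    obtain ⟨n, -, -, hn⟩ := hnear (ε / 2) (by positivity) 0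
    obtain ⟨y, hy, hxy⟩ := hn x (h1 n hx)
    exact ⟨y, hy, by linarith⟩
  have hconv : Convex ℝ (L : Set E3) := by
    intro x hx y hy a b ha hb hab
    rw [← hLcl.closure_eq, Metric.mem_closure_iff]
    intro ε hε
    obtain ⟨n, -, hn1, hn2⟩ := hnear (ε / 4) (by positivity) 0
    obtain ⟨x', hx', hxx⟩ := hn1 x hx
    obtain ⟨y', hy', hyy⟩ := hn1 y hy
    obtain ⟨z, hz, hzz⟩ := hn2 _ ((hK n).convex hx' hy' ha hb hab)
    refine ⟨z, hz, ?_⟩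
    have h3 : dist (a • x + b • y) (a • x' + b • y') ≤ ε / 4 := by
      refine (dist_add_add_le _ _ _ _).trans ?_
      rw [dist_smul₀, dist_smul₀, Real.norm_eq_abs, Real.norm_eq_abs, abs_of_nonneg ha,
        abs_of_nonneg hb]
      calc a * dist x x' + b * dist y y' ≤ a * (ε / 4) + b * (ε / 4) := by gcongr
        _ = ε / 4 := by rw [← add_mul, hab, one_mul]
    have h4 := dist_triangle (a • x + b • y) (a • x' + b • y') z
    linarith
  refine ⟨L, ⟨hconv, L.isCompact, ⟨0, ?_⟩⟩, fun ε hε hε1 N => ?_⟩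
  · rw [mem_interior_iff_mem_nhds]
    exact mem_of_superset (closedBall_mem_nhds 0 one_pos) hball
  · obtain ⟨n, hnN, hn1, hn2⟩ := hnear ε hε N
    refine ⟨n, hnN, fun x hx => ?_, fun x hx => ?_⟩
    · obtain ⟨y, hy, hxy⟩ := hn1 x hx
      exact smul_mem_of_near (hK n).convex (h1 n) hε hε1 hy hxy
    · obtain ⟨y, hy, hxy⟩ := hn2 x hx
      exact inv_smul_mem_of_near hconv hball hε hy hxy

end Semicontinuity

/-! ### The minimiser and its eccentricity -/

section Minimiser

/-- A homeomorphism of the ambient space carries the frontier of a convex body to the unit sphere,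
so minimising over embeddings amounts to minimising over bodies. -/
theorem IsSolidConvex.exists_isConvexEmbedding {K : Set E3} (hK : IsSolidConvex K) :
    ∃ f : S2 → E3, IsConvexEmbedding f ∧ range f = frontier K := by
  obtain ⟨h, -, -, hf⟩ := exists_homeomorph_image_interior_closure_frontier_eq_unitBall
    hK.convex hK.nonempty_interior hK.isCompact.isBounded
  have hr : range (fun x : S2 => h.symm (x : E3)) = frontier K := by
    rw [range_comp' h.symm Subtype.val, Subtype.range_coe, ← hf, ← image_comp]
    simp
  exact ⟨_, ⟨h.symm.isEmbedding.comp Topology.IsEmbedding.subtypeVal,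
    ⟨K, hK.convex, hK.isCompact, hK.nonempty_interior.mono interior_subset⟩,
    hK.nonempty_interior, hr⟩, hr⟩

theorem IsConvexEmbedding.exists_isSolidConvex {f : S2 → E3} (hf : IsConvexEmbedding f) :
    ∃ K : Set E3, IsSolidConvex K ∧ range f = frontier K := by
  obtain ⟨-, K, hK, hr⟩ := hf
  exact ⟨K, ⟨K.convex, K.isCompact, hK⟩, hr⟩

theorem exists_isSolidConvex_forall_distortion_le : ∃ L : Set E3, IsSolidConvex L ∧
    ∀ K : Set E3, IsSolidConvex K → distortion (frontier L) ≤ distortion (frontier K) := by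
  have hκ : (1.565 : ℝ) < Real.pi / 2 := by linarith [Real.pi_gt_d2]
  obtain ⟨C, hC, hball⟩ := exists_ball_of_distortion_le (by norm_num) hκ
  obtain ⟨K₀, hK₀1, hK₀2, hK₀3, hK₀⟩ := exists_convex_distortion_le
  set d := ⨅ (K : Set E3) (_ : IsSolidConvex K), distortion (frontier K) with hd
  have hd1 : d ≤ ENNReal.ofReal 1.56 := (iInf₂_le K₀ ⟨hK₀1, hK₀2, hK₀3⟩).trans hK₀
  have hdtop : d ≠ ⊤ := ne_top_of_le_ne_top ENNReal.ofReal_ne_top hd1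
  have hseq : ∀ n : ℕ, ∃ K : Set E3, IsSolidConvex K ∧
      distortion (frontier K) ≤ ENNReal.ofReal (d.toReal + 1 / (n + 1)) ∧
      closedBall 0 1 ⊆ K ∧ K ⊆ closedBall 0 C := by
    intro n
    -- The value `1.565` lies strictly between the distortion bound `1.56` of the cone and `π / 2`,
    -- so near-minimal bodies still have controlled eccentricity.
    have hlt : d < min (ENNReal.ofReal (d.toReal + 1 / (n + 1))) (ENNReal.ofReal 1.565) := by
      refine lt_min ?_ (hd1.trans_lt ?_)
      · conv_lhs => rw [← ENNReal.ofReal_toReal hdtop]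
        have : (0 : ℝ) < 1 / (n + 1) := by positivity
        exact (ENNReal.ofReal_lt_ofReal_iff (by positivity)).2 (by linarith)
      · exact (ENNReal.ofReal_lt_ofReal_iff (by norm_num)).2 (by norm_num)
    conv at hlt => lhs; rw [hd]
    simp only [iInf_lt_iff] at hlt
    obtain ⟨K, hK, hlt⟩ := hlt
    obtain ⟨c, r, hr, h1, h2⟩ := hball K hK.convex hK.isCompact hK.nonempty_interior
      (hlt.le.trans (min_le_right _ _))
    obtain ⟨K', hK', hle, h3, h4⟩ := hK.exists_normalised hr h1 h2
    exact ⟨K', hK', hle.trans (hlt.le.trans (min_le_left _ _)), h3, h4⟩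
  choose K hK hKd hK1 hK2 using hseq
  obtain ⟨L, hL, hlim⟩ := exists_limit_of_isSolidConvex hK hK1 hK2
  obtain ⟨R, hR⟩ := hL.isCompact.isBounded.exists_norm_le
  have hdle : ∀ K' : Set E3, IsSolidConvex K' → d ≤ distortion (frontier K') :=
    fun K' hK' => iInf₂_le K' hK'
  refine ⟨L, hL, fun K' hK' => le_trans ?_ (hdle K' hK')⟩
  refine distortion_le fun p hp q hq hpq => ?_
  have hbound : ∀ ε : ℝ, 0 < ε → ε < 1 → intrinsicEDist (frontier L) p q ≤
      ENNReal.ofReal ((d.toReal + ε) * (‖p - q‖ + 4 * ε * R / (1 - ε))) := by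
    intro ε hε hε1
    obtain ⟨N, hN⟩ := exists_nat_one_div_lt hε
    obtain ⟨n, hnN, h1, h2⟩ := hlim ε hε hε1 N
    refine hL.intrinsicEDist_le (hK n) hε hε1 (by positivity) h1 h2 hR ((hKd n).trans ?_) hp hq hpq
    refine ENNReal.ofReal_le_ofReal ?_
    have h3 : (1 : ℝ) / (n + 1) ≤ 1 / (N + 1) := by
      have : (N : ℝ) ≤ n := by exact_mod_cast hnN
      gcongr
    linarith
  have htend : Tendsto (fun ε : ℝ =>
      ENNReal.ofReal ((d.toReal + ε) * (‖p - q‖ + 4 * ε * R / (1 - ε)))) (𝓝[>] 0)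
      (𝓝 (ENNReal.ofReal (d.toReal * ‖p - q‖))) := by
    refine ENNReal.tendsto_ofReal ?_
    have hc : ContinuousAt (fun ε : ℝ => (d.toReal + ε) * (‖p - q‖ + 4 * ε * R / (1 - ε))) 0 := by
      refine ContinuousAt.mul (by fun_prop) (ContinuousAt.add (by fun_prop) ?_)
      exact ContinuousAt.div (by fun_prop) (by fun_prop) (by norm_num)
    have := hc.tendsto
    simp only [add_zero, mul_zero, zero_mul, sub_zero, zero_div] at this
    exact this.mono_left nhdsWithin_le_nhds
  have hle := ge_of_tendsto htend (by
    filter_upwards [Ioo_mem_nhdsGT (zero_lt_one' ℝ)] with ε hε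
    exact hbound ε hε.1 hε.2)
  rwa [ENNReal.ofReal_mul ENNReal.toReal_nonneg, ENNReal.ofReal_toReal hdtop, ← dist_eq_norm,
    ← edist_dist] at hle

/-- A connected set that avoids `frontier K` and meets `K` cannot leave `K`, so the component of an
interior point is bounded. -/
theorem interior_subset_enclosedRegion {K : Set E3} (hK : IsCompact K) :
    interior K ⊆ enclosedRegion (frontier K) := by
  intro x hx
  have hxf : x ∉ frontier K := fun h => h.2 hx
  refine ⟨hxf, hK.isBounded.subset fun y hy => ?_⟩
  by_contra hyK
  obtain ⟨z, hz, hzf⟩ := exists_mem_frontier_of_isPreconnected (s := K)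
    (isPreconnected_connectedComponentIn (F := (frontier K)ᶜ) (x := x))
    ⟨x, mem_connectedComponentIn hxf, interior_subset hx⟩ ⟨y, hy, hyK⟩
  exact connectedComponentIn_subset _ _ hz hzf

theorem eccentricity_frontier_le {K : Set E3} (hK : IsCompact K) {c : E3} {r C : ℝ} (hr : 0 < r)
    (hC : 0 < C) (h1 : ball c r ⊆ K) (h2 : K ⊆ closedBall c (C * r)) :
    eccentricity (frontier K) ≤ ENNReal.ofReal C := by
  have hcirc : circumradius (frontier K) ≤ ENNReal.ofReal (C * r) := by
    refine (iInf_le _ c).trans (iSup₂_le fun x hx => ?_)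
    rw [edist_dist]
    exact ENNReal.ofReal_le_ofReal (h2 (hK.isClosed.frontier_subset hx))
  have hin : ENNReal.ofReal r ≤ inradius (frontier K) := by
    have hsub : ball c (r.toNNReal : ℝ) ⊆ enclosedRegion (frontier K) := by
      rw [Real.coe_toNNReal _ hr.le]
      exact (interior_maximal h1 isOpen_ball).trans (interior_subset_enclosedRegion hK)
    exact le_iSup_of_le c (le_iSup₂_of_le r.toNNReal hsub le_rfl)
  have hr0 : ENNReal.ofReal r ≠ 0 := by simpa using hr
  calc eccentricity (frontier K) ≤ ENNReal.ofReal (C * r) / ENNReal.ofReal r :=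
        ENNReal.div_le_div hcirc hin
    _ = ENNReal.ofReal C := by
        rw [ENNReal.ofReal_mul hC.le, ENNReal.mul_div_cancel_right hr0 ENNReal.ofReal_ne_top]

end Minimiser

end ConvexSphere

open ConvexSphere

theorem theorem2 :
    (∃ f : ConvexSphere.S2 → ConvexSphere.E3, ConvexSphere.IsConvexMinimiser f) ∧
      ∃ C : ℝ≥0, ∀ f : ConvexSphere.S2 → ConvexSphere.E3, ConvexSphere.IsConvexMinimiser f →
        ConvexSphere.eccentricity (Set.range f) ≤ (C : ℝ≥0∞) := by
  constructor
  · obtain ⟨L, hL, hmin⟩ := exists_isSolidConvex_forall_distortion_le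
    obtain ⟨f, hf, hfr⟩ := hL.exists_isConvexEmbedding
    refine ⟨f, hf, fun g hg => ?_⟩
    obtain ⟨K, hK, hgr⟩ := hg.exists_isSolidConvex
    rw [hfr, hgr]
    exact hmin K hK
  · have hκ : (1.56 : ℝ) < Real.pi / 2 := by linarith [Real.pi_gt_d2]
    obtain ⟨C, hC, hball⟩ := exists_ball_of_distortion_le (by norm_num) hκ
    obtain ⟨K₀, hK₀1, hK₀2, hK₀3, hK₀⟩ := exists_convex_distortion_le
    obtain ⟨g, hg, hgr⟩ := IsSolidConvex.exists_isConvexEmbedding ⟨hK₀1, hK₀2, hK₀3⟩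
    refine ⟨C.toNNReal, fun f hf => ?_⟩
    obtain ⟨K, hK, hfr⟩ := hf.1.exists_isSolidConvex
    have hle := hf.2 g hg
    rw [hfr, hgr] at hle
    obtain ⟨c, r, hr, h1, h2⟩ := hball K hK.convex hK.isCompact hK.nonempty_interior
      (hle.trans hK₀)
    rw [hfr]
    exact eccentricity_frontier_le hK.isCompact hr hC h1 h2
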